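/- Let $k_1,k_2\ge 1$, and let $f_j:L_j\to\mathbb S^{2n_j+1}\subset\mathbb C^{n_j+1}$ ($j=1,2$) be smooth minimal immersions of nonempty smooth manifolds of dimension $k_j$ which are $C$-totally real, i.e. $i f_j(x)$ is orthogonal to the tangent space $df_j(T_xL_j)$ for every $x\in L_j$. Let $T\subset\mathbb R$ be an open interval and let $\gamma=(\gamma_1,\gamma_2):T\to\mathbb S^3\subset\mathbb C\oplus\mathbb C$ be a $C^2$ immersed curve with $\gamma_1\gamma_2\neq 0$ everywhere. Put $$G_\gamma(t,x,y)=(\gamma_1(t)f_1(x),\gamma_2(t)f_2(y)),\qquad (t,x,y)\in T\times L_1\times L_2,$$ and let $g_\gamma$ be the Riemannian metric on $T\times L_1\times L_2$ induced by $G_\gamma$ from the Euclidean metric of $\mathbb C^{n_1+1}\oplus\mathbb C^{n_2+1}$. Then $$\Delta_{g_\gamma}G_\gamma=-(k_1+k_2+1)\,G_\gamma\quad\text{on } T\times L_1\times L_2$$ if and only if $G_\gamma$ is a spiral minimal product of $f_1$ and $f_2$, of varying or of steady magnitudes, in the following sense. Write $\gamma_1=a e^{is_1}$ and $\gamma_2=b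 e^{is_2}$ with $a=\cos s$, $b=\sin s$, where $s:T\to(0,\frac{\pi}{2})$ and $s_1,s_2:T\to\mathbb R$ are $C^2$, and let $t_{arc}$ be arc length along $\gamma$. We say that $\gamma$ is a solution curve with parameters $(c_1,c_2)\in\mathbb R^2$ if $$\frac{ds_1}{dt_{arc}}=\frac{c_1}{a^{k_1+2}b^{k_2}},\qquad \frac{ds_2}{dt_{arc}}=\frac{c_2}{a^{k_1}b^{k_2+2}}\qquad\text{on } T.$$ For $c_1\ne0$ we put $C_1=c_2/c_1$ and $C_2=1/c_1^2$; wherever $s'\neq0$ the equations then say that $$\left(\frac{ds_1}{ds},\frac{ds_2}{ds}\right)=\pm\frac{(\tan s,\;C_1\cot s)}{\sqrt{C_2\cos^{2k_1+2}s\,\sin^{2k_2+2}s-1-(C_1^2-1)\cos^2 s}}.$$ The case $c_1=0$ consists of the limiting parameters $C_1=\infty$ (if $c_2\neq0$) and $C_2=\infty$ (if $c_2=0$, when $s_1$ and $s_2$ are constant). The product $G_\gamma$ is a spiral minimal product * of varying magnitudes, if $\gamma$ is a solution curve for some $(c_1,c_2)$ and $s$ is not constant; * of steady magnitudes, if $\gamma$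 is a solution curve for some $(c_1,c_2)$, $s\equiv\sigma$ is constant, and $$(c_2^2-c_1^2)\cos^2\sigma\,\bigl(2k_1\tan\sigma-(2k_2+2)\cot\sigma\bigr)=c_1^2\bigl(-(2k_1+2)\tan\sigma+(2k_2+2)\cot\sigma\bigr).$$ -/

import Mathlib

open scoped Manifold ContDiff

noncomputable section

section Submanifolds

/-! Immersed submanifolds of a complex Hermitian space `W`, viewed as a real Euclidean space with
the real inner product `Re ⟨v, w⟩` and the complex structure `v ↦ Complex.I • v`. `E` is the model
vector space of the manifold `M`, and `b` a basis of `E`, giving coordinates in every chart. -/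

variable {ι E H M W : Type*} [Fintype ι] [DecidableEq ι]
  [NormedAddCommGroup E] [NormedSpace ℝ E] [TopologicalSpace H]
  [TopologicalSpace M] [ChartedSpace H M]
  [NormedAddCommGroup W] [InnerProductSpace ℂ W]

/-- The real inner product `Re ⟨v, w⟩` of `W`. -/
def realInner (v w : W) : ℝ := (inner ℂ v w).re

/-- The coordinate expression of `f` in the preferred chart around `p`. -/
def coordRep (J : ModelWithCorners ℝ E H) (f : M → W) (p : M) : E → W :=
  fun u => f ((extChartAt J p).symm u)

/-- The partial derivative `∂_i F` with respect to the basis `b`. -/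
def coordDeriv (b : Module.Basis ι ℝ E) (i : ι) (F : E → W) : E → W :=
  fun u => fderiv ℝ F u (b i)

/-- The coefficients `g_ij = ⟨∂_i F, ∂_j F⟩` of the metric induced by `F`. -/
def inducedMetric (b : Module.Basis ι ℝ E) (F : E → W) (u : E) : Matrix ι ι ℝ :=
  Matrix.of fun i j => realInner (coordDeriv b i F u) (coordDeriv b j F u)

/-- The Laplace-Beltrami operator of the metric `g` in coordinates:
`(1/√det g) ∑ i j, ∂_i (√det g * g^{ij} * ∂_j Φ)`. -/
def coordLaplacian (b : Module.Basis ι ℝ E) (g : E → Matrix ι ι ℝ) (Φ : E → W) (u : E) : W :=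
  (Real.sqrt (g u).det)⁻¹ • ∑ i, ∑ j,
    coordDeriv b i (fun v => (Real.sqrt (g v).det * (g v)⁻¹ i j) • coordDeriv b j Φ v) u

/-- `Δ_g f` at `p`, where `g` is the metric on `M` induced by the immersion `f`. -/
def inducedLaplacian (J : ModelWithCorners ℝ E H) (b : Module.Basis ι ℝ E) (f : M → W) (p : M) :
    W :=
  coordLaplacian b (inducedMetric b (coordRep J f p)) (coordRep J f p) (extChartAt J p p)

/-- `tr_g` of the Hessian `∂_i ∂_j F` in coordinates. Its inner product with a unit vector `ν`
normal to the immersion is the trace of the second fundamental form in direction `ν`. -/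
def traceHessian (b : Module.Basis ι ℝ E) (F : E → W) (u : E) : W :=
  ∑ i, ∑ j, ((inducedMetric b F u)⁻¹ i j) • coordDeriv b i (coordDeriv b j F) u

/-- `f` is a smooth minimal immersion into the unit sphere of `W`: the trace of its second
fundamental form vanishes in every direction `ν` tangent to the sphere and normal to `f`. -/
structure IsMinimalImmersionInSphere (J : ModelWithCorners ℝ E H) (b : Module.Basis ι ℝ E)
    (f : M → W) : Prop where
  smooth : ContMDiff J 𝓘(ℝ, W) ∞ f
  norm_eq_one : ∀ p, ‖f p‖ = 1
  immersion : ∀ p, Function.Injective (mfderiv J 𝓘(ℝ, W) f p)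
  minimal : ∀ (p : M) (ν : W), realInner ν (f p) = 0 →
    (∀ i, realInner ν (coordDeriv b i (coordRep J f p) (extChartAt J p p)) = 0) →
      realInner ν (traceHessian b (coordRep J f p) (extChartAt J p p)) = 0

/-- `J x ⟂ T_x L` at every point of the immersed submanifold. -/
def IsCTotallyReal (J : ModelWithCorners ℝ E H) (f : M → W) : Prop :=
  ∀ (p : M) (v : TangentSpace J p),
    realInner (Complex.I • f p) (mfderiv J 𝓘(ℝ, W) f p v : W) = 0

end Submanifolds

/-- The standard coordinate basis of `ℝᵏ`. -/
abbrev stdBasis (k : ℕ) : Module.Basis (Fin k) ℝ (EuclideanSpace ℝ (Fin k)) :=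
  (EuclideanSpace.basisFun (Fin k) ℝ).toBasis

/-- The standard coordinate basis of `ℝ × ℝ^k₁ × ℝ^k₂`. -/
abbrev prodBasis (k₁ k₂ : ℕ) : Module.Basis (Unit ⊕ (Fin k₁ ⊕ Fin k₂)) ℝ
    (ℝ × (EuclideanSpace ℝ (Fin k₁) × EuclideanSpace ℝ (Fin k₂))) :=
  (Module.Basis.singleton Unit ℝ).prod ((stdBasis k₁).prod (stdBasis k₂))

/-- The map `G_γ (t, x, y) = (γ₁ t • f₁ x, γ₂ t • f₂ y)`. -/
def spiralProduct {L₁ L₂ W₁ W₂ : Type*}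
    [NormedAddCommGroup W₁] [InnerProductSpace ℂ W₁]
    [NormedAddCommGroup W₂] [InnerProductSpace ℂ W₂]
    (γ₁ γ₂ : ℝ → ℂ) (f₁ : L₁ → W₁) (f₂ : L₂ → W₂) : ℝ × (L₁ × L₂) → WithLp 2 (W₁ × W₂) :=
  fun p => WithLp.toLp 2 (γ₁ p.1 • f₁ p.2.1, γ₂ p.1 • f₂ p.2.2)

section Curves

/-- `γ = (γ₁, γ₂)`, defined on `T`, is a `C²` immersed curve in `S³ ⊂ ℂ ⊕ ℂ`. -/
structure IsImmersedCurveInSphere (T : Set ℝ) (γ₁ γ₂ : ℝ → ℂ) : Prop where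
  contDiff_fst : ContDiffOn ℝ 2 γ₁ T
  contDiff_snd : ContDiffOn ℝ 2 γ₂ T
  mem_sphere : ∀ t ∈ T, ‖γ₁ t‖ ^ 2 + ‖γ₂ t‖ ^ 2 = 1
  immersed : ∀ t ∈ T, deriv γ₁ t ≠ 0 ∨ deriv γ₂ t ≠ 0

/-- The speed `dt_arc / dt` of the curve `(γ₁, γ₂)`. -/
def curveSpeed (γ₁ γ₂ : ℝ → ℂ) (t : ℝ) : ℝ :=
  Real.sqrt (‖deriv γ₁ t‖ ^ 2 + ‖deriv γ₂ t‖ ^ 2)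

/-- `γ₁ = a e^{i s₁}` and `γ₂ = b e^{i s₂}` with magnitudes `a = cos s` and `b = sin s`, where
`s`, `s₁`, `s₂` are `C²` functions on `T`. -/
structure IsPolarForm (T : Set ℝ) (γ₁ γ₂ : ℝ → ℂ) (s s₁ s₂ : ℝ → ℝ) : Prop where
  contDiff : ContDiffOn ℝ 2 s T
  contDiff_fst : ContDiffOn ℝ 2 s₁ T
  contDiff_snd : ContDiffOn ℝ 2 s₂ T
  mem_Ioo : ∀ t ∈ T, s t ∈ Set.Ioo 0 (Real.pi / 2)
  fst_eq : ∀ t ∈ T, γ₁ t = (Real.cos (s t) : ℂ) * Complex.exp ((s₁ t : ℂ) * Complex.I)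
  snd_eq : ∀ t ∈ T, γ₂ t = (Real.sin (s t) : ℂ) * Complex.exp ((s₂ t : ℂ) * Complex.I)

/-- The equations of a solution curve, for a polar form `(s, s₁, s₂)` of `γ` and parameters
`c₁ c₂`:
`ds₁ / dt_arc = c₁ / (a ^ (k₁ + 2) * b ^ k₂)` and `ds₂ / dt_arc = c₂ / (a ^ k₁ * b ^ (k₂ + 2))`.
If `c₁ ≠ 0`, write `c₁ = ±1 / √C₂` and `c₂ = C₁ * c₁`; then `b² s₂' = C₁ a² s₁'`, and wherever
`s' ≠ 0` these are the equations
`(ds₁ / ds, ds₂ / ds) = ± (C₂ a^(2k₁+2) b^(2k₂+2) - 1 - (C₁² - 1) a²)^(-1/2) * (tan s, C₁ cot s)`.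
The parameters with `c₁ = 0` are the limits `C₁ = ∞` (`c₂ ≠ 0`) and `C₂ = ∞` (`c₂ = 0`). -/
structure IsSolutionCurve (k₁ k₂ : ℕ) (c₁ c₂ : ℝ) (T : Set ℝ) (γ₁ γ₂ : ℝ → ℂ)
    (s s₁ s₂ : ℝ → ℝ) : Prop where
  polar : IsPolarForm T γ₁ γ₂ s s₁ s₂
  fst_eq : ∀ t ∈ T, deriv s₁ t =
    c₁ / (Real.cos (s t) ^ (k₁ + 2) * Real.sin (s t) ^ k₂) * curveSpeed γ₁ γ₂ t
  snd_eq : ∀ t ∈ T, deriv s₂ t =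
    c₂ / (Real.cos (s t) ^ k₁ * Real.sin (s t) ^ (k₂ + 2)) * curveSpeed γ₁ γ₂ t

/-- The curve generates a spiral minimal product of varying magnitudes. -/
def IsVaryingSolutionCurve (k₁ k₂ : ℕ) (T : Set ℝ) (γ₁ γ₂ : ℝ → ℂ) : Prop :=
  ∃ (c₁ c₂ : ℝ) (s s₁ s₂ : ℝ → ℝ), IsSolutionCurve k₁ k₂ c₁ c₂ T γ₁ γ₂ s s₁ s₂ ∧
    ∃ t ∈ T, ∃ t' ∈ T, s t ≠ s t'

/-- The curve generates a spiral minimal product of steady magnitudes: `s` is a constant `σ`, and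
`(C₁² - 1) cos² σ (2k₁ tan σ - (2k₂+2) cot σ) = -(2k₁+2) tan σ + (2k₂+2) cot σ`
with `C₁ = c₂ / c₁` (denominators cleared). -/
def IsSteadySolutionCurve (k₁ k₂ : ℕ) (T : Set ℝ) (γ₁ γ₂ : ℝ → ℂ) : Prop :=
  ∃ (c₁ c₂ σ : ℝ) (s s₁ s₂ : ℝ → ℝ), IsSolutionCurve k₁ k₂ c₁ c₂ T γ₁ γ₂ s s₁ s₂ ∧
    (∀ t ∈ T, s t = σ) ∧
    (c₂ ^ 2 - c₁ ^ 2) * Real.cos σ ^ 2 *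
        (2 * k₁ * Real.tan σ - (2 * k₂ + 2) * Real.cot σ) =
      c₁ ^ 2 * (-(2 * k₁ + 2) * Real.tan σ + (2 * k₂ + 2) * Real.cot σ)

end Curves

end

noncomputable section

/-! ### The real inner product, and calculus of the induced metric. -/

section Submanifolds

variable {ι E W : Type*} [NormedAddCommGroup E] [NormedSpace ℝ E]
  [NormedAddCommGroup W] [InnerProductSpace ℂ W]
  {b : Module.Basis ι ℝ E} {F : E → W} {u : E}

/-! For an immersion `F` with induced metric `g`, the vector `Δ_g F` is normal and differs from
`tr_g ∂²F` by a tangent vector. If moreover `F` itself is normal to the immersion, then `Δ_g F = -N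
F` holds exactly when `tr_g ∂²F + N F` is tangent (`coordLaplacian_eq_smul_iff`).

For the product, the sphere condition and the `C`-totally real condition together say that `f_j` is
Hermitian orthogonal to its derivatives. This survives multiplication by the complex numbers `γ_j`
and `γ_j'`, so the metric is block diagonal. Minimality replaces `tr ∂²f_j` by `-k_j f_j` modulo
tangent vectors. Comparing the coefficients of `f_1` and `f_2` leaves a second order equation for
`γ` alone, `SpiralEquation` (`coordLaplacian_spiralProduct_iff`).

In polar form this equation has two angular components and one radial component. The angular ones
say that `s₁' a^(k₁+2) b^k₂ / |γ'|` and `s₂' a^k₁ b^(k₂+2) / |γ'|` are constant; these constants are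
`c₁` and `c₂`. For such a curve let `R` be the defect of the radial equation (`polarResidual`).
Differentiating the speed gives `s' R = 0` (`IsSolutionCurve.deriv_mul_residual`). If `s` is
constant, `R = 0` is the steady equation, by algebra.

If `s` varies, `R = 0` must also be shown where `s' = 0`. The magnitude `z = a²` satisfies `z'² = 4
|γ'|² P(z) / (a^k₁ b^k₂)²`, with `P` the polynomial `energyPoly`. At a point where `s' = s'' = R =
0`, the polynomial has a double root, and uniqueness for the resulting equation forces `z` to be
constant (`IsSolutionCurve.eq_of_polarForce_eq_zero`). So a varying curve has no such point, and
connectedness of `T` excludes `R ≠ 0` (`IsSolutionCurve.polarResidual_eq_zero_of_varying`). -/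

lemma realInner_comm (v w : W) : realInner v w = realInner w v := by
  rw [realInner, realInner, ← inner_conj_symm, Complex.conj_re]

lemma realInner_add_left (v w z : W) : realInner (v + w) z = realInner v z + realInner w z := by
  simp [realInner]

lemma realInner_smul_left (c : ℝ) (v w : W) : realInner (c • v) w = c * realInner v w := by
  rw [realInner, ← Complex.coe_smul, inner_smul_left]
  simp [realInner]

lemma realInner_add_right (v w z : W) : realInner v (w + z) = realInner v w + realInner v z := by
  simp [realInner]

lemma realInner_smul_right (c : ℝ) (v w : W) : realInner v (c • w) = c * realInner v w := by
  rw [realInner_comm, realInner_smul_left, realInner_comm]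

lemma realInner_sum_left {κ : Type*} (s : Finset κ) (f : κ → W) (w : W) :
    realInner (∑ i ∈ s, f i) w = ∑ i ∈ s, realInner (f i) w := by
  simp [realInner]

lemma realInner_sum_right {κ : Type*} (s : Finset κ) (f : κ → W) (w : W) :
    realInner w (∑ i ∈ s, f i) = ∑ i ∈ s, realInner w (f i) := by
  simp [realInner]

lemma realInner_self (v : W) : realInner v v = ‖v‖ ^ 2 :=
  inner_self_eq_norm_sq (𝕜 := ℂ) v

lemma ContDiffAt.realInner {F G : E → W} {u : E} {n : WithTop ℕ∞} (hF : ContDiffAt ℝ n F u)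
    (hG : ContDiffAt ℝ n G u) : ContDiffAt ℝ n (fun v => realInner (F v) (G v)) u := by
  -- `realInner` unfolds to the inner product of this underlying real structure; the instance is
  -- kept local.
  let _ : InnerProductSpace ℝ W := InnerProductSpace.rclikeToReal ℂ W
  exact hF.inner ℝ hG

lemma fderiv_realInner_apply {F G : E → W} {u : E} (hF : DifferentiableAt ℝ F u)
    (hG : DifferentiableAt ℝ G u) (w : E) :
    fderiv ℝ (fun v => realInner (F v) (G v)) u w =
      realInner (fderiv ℝ F u w) (G u) + realInner (F u) (fderiv ℝ G u w) := by
  let _ : InnerProductSpace ℝ W := InnerProductSpace.rclikeToReal ℂ W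
  rw [add_comm]
  exact fderiv_inner_apply ℝ hF hG w

lemma ContDiffAt.coordDeriv {n m : WithTop ℕ∞} (hF : ContDiffAt ℝ n F u) (hmn : m + 1 ≤ n)
    (i : ι) : ContDiffAt ℝ m (coordDeriv b i F) u :=
  (hF.fderiv_right hmn).clm_apply contDiffAt_const

lemma coordDeriv_comm (hF : ContDiffAt ℝ 2 F u) (i j : ι) :
    coordDeriv b i (coordDeriv b j F) u = coordDeriv b j (coordDeriv b i F) u := by
  have h : DifferentiableAt ℝ (fderiv ℝ F) u :=
    (hF.fderiv_right (m := 1) (by norm_num)).differentiableAt (by norm_num)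
  have key : ∀ i j, _root_.coordDeriv b i (_root_.coordDeriv b j F) u =
      fderiv ℝ (fderiv ℝ F) u (b i) (b j) := by
    intro i j
    unfold _root_.coordDeriv
    rw [fderiv_clm_apply h (differentiableAt_const _)]
    simp
  rw [key, key]
  exact hF.isSymmSndFDerivAt (by simp) _ _

lemma inducedMetric_isSymm (v : E) (i j : ι) :
    inducedMetric b F v i j = inducedMetric b F v j i := realInner_comm _ _

lemma ContDiffAt.inducedMetric (hF : ContDiffAt ℝ 2 F u) (i j : ι) :
    ContDiffAt ℝ 1 (fun v => inducedMetric b F v i j) u :=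
  (hF.coordDeriv (b := b) (by norm_num) i).realInner (hF.coordDeriv (b := b) (by norm_num) j)

variable [Fintype ι] [DecidableEq ι]

/-- Expansion of a determinant along a replaced row. -/
lemma Matrix.det_updateRow_eq_sum_adjugate (A : Matrix ι ι ℝ) (i : ι) (v : ι → ℝ) :
    (A.updateRow i v).det = ∑ j, v j * A.adjugate j i := by
  have h := congrFun (Matrix.cramer_eq_adjugate_mulVec A.transpose v) i
  rw [Matrix.cramer_apply, Matrix.updateCol_transpose, Matrix.det_transpose] at h
  rw [h, ← Matrix.adjugate_transpose]
  simp [Matrix.mulVec, dotProduct, mul_comm]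

/-- Jacobi's formula for the derivative of a determinant. -/
lemma fderiv_det_apply {g : E → Matrix ι ι ℝ} {u : E}
    (hg : ∀ i j, DifferentiableAt ℝ (fun v => g v i j) u) (w : E) :
    fderiv ℝ (fun v => (g v).det) u w =
      ∑ i, ∑ j, fderiv ℝ (fun v => g v i j) u w * (g u).adjugate j i := by
  let D : ContinuousMultilinearMap ℝ (fun _ : ι => ι → ℝ) ℝ :=
    { (Matrix.detRowAlternating (n := ι) (R := ℝ)).toMultilinearMap with
      cont := by
        change Continuous fun A : Matrix ι ι ℝ => A.det
        exact continuous_id.matrix_det }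
  have h1 := D.hasFDerivAt (fun i j => g u i j)
  have h2 : HasFDerivAt (fun v => fun i j => g v i j)
      (ContinuousLinearMap.pi fun i => ContinuousLinearMap.pi fun j =>
        fderiv ℝ (fun v => g v i j) u) u := by
    rw [hasFDerivAt_pi']
    intro i
    rw [hasFDerivAt_pi']
    exact fun j => (hg i j).hasFDerivAt
  have h3 := (h1.comp u h2).fderiv
  have h4 : fderiv ℝ (fun v => (g v).det) u = _ := h3
  rw [h4]
  simp only [ContinuousLinearMap.comp_apply, ContinuousMultilinearMap.linearDeriv_apply]
  refine Finset.sum_congr rfl fun i _ => ?_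
  exact Matrix.det_updateRow_eq_sum_adjugate (g u) i _

lemma ContDiffAt.matrix_det {g : E → Matrix ι ι ℝ} {u : E} {n : WithTop ℕ∞}
    (hg : ∀ i j, ContDiffAt ℝ n (fun v => g v i j) u) :
    ContDiffAt ℝ n (fun v => (g v).det) u := by
  simp only [Matrix.det_apply']
  exact ContDiffAt.sum fun σ _ => contDiffAt_const.mul (contDiffAt_prod fun i _ => hg _ _)

/-- Cramer's rule: each entry of the inverse is a quotient of determinants, the numerator being that
of `g` with one row replaced by constants. -/
lemma ContDiffAt.matrix_inv {g : E → Matrix ι ι ℝ} {u : E} {n : WithTop ℕ∞}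
    (hg : ∀ i j, ContDiffAt ℝ n (fun v => g v i j) u) (h0 : (g u).det ≠ 0) (i j : ι) :
    ContDiffAt ℝ n (fun v => (g v)⁻¹ i j) u := by
  simp only [Matrix.inv_def, Ring.inverse_eq_inv', Matrix.smul_apply, smul_eq_mul,
    Matrix.adjugate_apply]
  refine ((ContDiffAt.matrix_det hg).inv h0).mul (ContDiffAt.matrix_det fun k l => ?_)
  by_cases hk : k = j
  · subst hk
    simpa using contDiffAt_const
  · simpa [Matrix.updateRow_ne hk] using hg k l

/-- The metric is the Gram matrix of the partial derivatives, hence positive definite when they are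
independent. -/
lemma inducedMetric_det_pos (hli : LinearIndependent ℝ fun i => coordDeriv b i F u) :
    0 < (inducedMetric b F u).det := by
  let _ : InnerProductSpace ℝ W := InnerProductSpace.rclikeToReal ℂ W
  exact (Matrix.posDef_gram_of_linearIndependent hli).det_pos

lemma inducedMetric_inv_isSymm (v : E) (i j : ι) :
    (inducedMetric b F v)⁻¹ i j = (inducedMetric b F v)⁻¹ j i := by
  have h : (inducedMetric b F v).transpose = inducedMetric b F v := by
    ext i j; exact inducedMetric_isSymm v j i
  have h2 := Matrix.transpose_nonsing_inv (inducedMetric b F v)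
  rw [h] at h2
  exact congrFun (congrFun h2 j) i

end Submanifolds

/-! ### The Laplacian of an immersion. -/

section Submanifolds

variable {ι E W : Type*} [Fintype ι] [DecidableEq ι]
  [NormedAddCommGroup E] [NormedSpace ℝ E]
  [NormedAddCommGroup W] [InnerProductSpace ℂ W]
  {b : Module.Basis ι ℝ E} {F : E → W} {u : E}

lemma eventually_inducedMetric_det_ne_zero (hF : ContDiffAt ℝ 2 F u)
    (hli : LinearIndependent ℝ fun i => coordDeriv b i F u) :
    ∀ᶠ v in nhds u, (inducedMetric b F v).det ≠ 0 :=
  (ContDiffAt.matrix_det fun i j => hF.inducedMetric (b := b) i j).continuousAt.eventually_ne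
    (inducedMetric_det_pos hli).ne'

/-- The coefficients `√det g * g^{ij}` of the Laplace-Beltrami operator are `C¹`. -/
lemma contDiffAt_laplacianCoeff (hF : ContDiffAt ℝ 2 F u)
    (hli : LinearIndependent ℝ fun i => coordDeriv b i F u) (i j : ι) :
    ContDiffAt ℝ 1 (fun v => Real.sqrt (inducedMetric b F v).det *
      (inducedMetric b F v)⁻¹ i j) u :=
  ((ContDiffAt.matrix_det fun i j => hF.inducedMetric (b := b) i j).sqrt
    (inducedMetric_det_pos hli).ne').mul
    (ContDiffAt.matrix_inv (fun i j => hF.inducedMetric (b := b) i j)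
      (inducedMetric_det_pos hli).ne' i j)

/-- The Laplacian of an immersion differs from the trace of its Hessian by a tangent vector. -/
lemma coordLaplacian_eq_traceHessian_add (hF : ContDiffAt ℝ 2 F u)
    (hli : LinearIndependent ℝ fun i => coordDeriv b i F u) :
    ∃ l : ι → ℝ, coordLaplacian b (inducedMetric b F) F u =
      traceHessian b F u + ∑ j, l j • coordDeriv b j F u := by
  set r := Real.sqrt (inducedMetric b F u).det with hr
  have hr0 : r ≠ 0 := (Real.sqrt_pos.mpr (inducedMetric_det_pos hli)).ne'
  have hd : ∀ i j, coordDeriv b i (fun v => (Real.sqrt (inducedMetric b F v).det *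
      (inducedMetric b F v)⁻¹ i j) • coordDeriv b j F v) u =
      (r * (inducedMetric b F u)⁻¹ i j) • coordDeriv b i (coordDeriv b j F) u +
      fderiv ℝ (fun v => Real.sqrt (inducedMetric b F v).det *
        (inducedMetric b F v)⁻¹ i j) u (b i) • coordDeriv b j F u := by
    intro i j
    have h1 := (contDiffAt_laplacianCoeff hF hli i j).differentiableAt (by norm_num)
    have h2 := (hF.coordDeriv (b := b) (m := 1) (by norm_num) j).differentiableAt (by norm_num)
    rw [coordDeriv, fderiv_fun_smul h1 h2]
    simp [coordDeriv, hr]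
  refine ⟨fun j => r⁻¹ * ∑ i, fderiv ℝ (fun v => Real.sqrt (inducedMetric b F v).det *
        (inducedMetric b F v)⁻¹ i j) u (b i), ?_⟩
  simp only [coordLaplacian, hd, Finset.sum_add_distrib, smul_add]
  congr 1
  · simp only [traceHessian, Finset.smul_sum, smul_smul]
    refine Finset.sum_congr rfl fun i _ => Finset.sum_congr rfl fun j _ => ?_
    rw [← hr, inv_mul_cancel_left₀ hr0]
  · rw [Finset.sum_comm]
    simp only [Finset.smul_sum, mul_smul, Finset.sum_smul, hr]

/-- Jacobi's formula, with the adjugate rewritten as the determinant times the inverse. -/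
lemma fderiv_sqrt_det_apply (hF : ContDiffAt ℝ 2 F u)
    (hli : LinearIndependent ℝ fun i => coordDeriv b i F u) (w : E) :
    fderiv ℝ (fun v => Real.sqrt (inducedMetric b F v).det) u w =
      (1 / 2) * ∑ i, ∑ j, Real.sqrt (inducedMetric b F u).det * (inducedMetric b F u)⁻¹ i j *
        fderiv ℝ (fun v => inducedMetric b F v i j) u w := by
  have hdet := inducedMetric_det_pos hli
  have h1 : DifferentiableAt ℝ (fun v => (inducedMetric b F v).det) u :=
    (ContDiffAt.matrix_det fun i j => hF.inducedMetric (b := b) i j).differentiableAt (by norm_num)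
  rw [fderiv_sqrt h1 hdet.ne']
  simp only [smul_apply, smul_eq_mul]
  rw [fderiv_det_apply fun i j => (hF.inducedMetric i j).differentiableAt (by norm_num)]
  simp only [Finset.mul_sum]
  refine Finset.sum_congr rfl fun i _ => Finset.sum_congr rfl fun j _ => ?_
  rw [inducedMetric_inv_isSymm, Matrix.inv_def, Ring.inverse_eq_inv', Matrix.smul_apply,
    smul_eq_mul]
  have hs := Real.sq_sqrt hdet.le
  have hs0 := (Real.sqrt_pos.mpr hdet).ne'
  nth_rewrite 3 [← hs]
  field_simp

/-- The Laplacian of an immersion is normal to it. -/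
lemma realInner_coordLaplacian_coordDeriv (hF : ContDiffAt ℝ 2 F u)
    (hli : LinearIndependent ℝ fun i => coordDeriv b i F u) (k : ι) :
    realInner (coordLaplacian b (inducedMetric b F) F u) (coordDeriv b k F u) = 0 := by
  set c : ι → ι → E → ℝ := fun i j v => Real.sqrt (inducedMetric b F v).det *
      (inducedMetric b F v)⁻¹ i j with hc
  have hcd : ∀ i j, DifferentiableAt ℝ (c i j) u := fun i j =>
    (contDiffAt_laplacianCoeff hF hli i j).differentiableAt (by norm_num)
  have hd : ∀ j, DifferentiableAt ℝ (coordDeriv b j F) u := fun j =>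
    (hF.coordDeriv (b := b) (m := 1) (by norm_num) j).differentiableAt (by norm_num)
  have hg : ∀ i j, DifferentiableAt ℝ (fun v => inducedMetric b F v i j) u := fun i j =>
    (hF.inducedMetric i j).differentiableAt (by norm_num)
  -- The product rule, used to move the outer derivative off the pairing with `∂_k F`.
  have hterm : ∀ i j, realInner (coordDeriv b i (fun v => c i j v • coordDeriv b j F v) u)
      (coordDeriv b k F u) = fderiv ℝ (fun v => c i j v * inducedMetric b F v j k) u (b i) -
        c i j u * realInner (coordDeriv b j F u) (coordDeriv b k (coordDeriv b i F) u) := by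
    intro i j
    have h := fderiv_realInner_apply ((hcd i j).smul (hd j)) (hd k) (b i)
    simp only [Pi.smul_apply', realInner_smul_left] at h
    rw [coordDeriv_comm hF k i]
    exact eq_sub_of_add_eq h.symm
  -- Contracting `g^{ij}` with `g_jk` gives the identity matrix throughout a neighbourhood of `u`,
  -- so only the derivative of `√det g` remains.
  have hsum : ∀ i, ∑ j, fderiv ℝ (fun v => c i j v * inducedMetric b F v j k) u (b i) =
      if i = k then fderiv ℝ (fun v => Real.sqrt (inducedMetric b F v).det) u (b i) else 0 := by
    intro i
    have h1 : fderiv ℝ (fun v => ∑ j, c i j v * inducedMetric b F v j k) u (b i) =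
        ∑ j, fderiv ℝ (fun v => c i j v * inducedMetric b F v j k) u (b i) := by
      have h2 : ∀ j ∈ Finset.univ, DifferentiableAt ℝ
          (fun v => c i j v * inducedMetric b F v j k) u := fun j _ => (hcd i j).mul (hg j k)
      rw [fderiv_fun_sum h2]
      simp
    rw [← h1]
    have h2 : (fun v => ∑ j, c i j v * inducedMetric b F v j k) =ᶠ[nhds u]
        fun v => Real.sqrt (inducedMetric b F v).det * (1 : Matrix ι ι ℝ) i k := by
      filter_upwards [eventually_inducedMetric_det_ne_zero hF hli] with v hv
      rw [← Matrix.nonsing_inv_mul (inducedMetric b F v) (isUnit_iff_ne_zero.mpr hv),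
        Matrix.mul_apply, Finset.mul_sum]
      simp only [hc, mul_assoc]
    rw [h2.fderiv_eq]
    split_ifs with hik
    · subst hik
      simp only [Matrix.one_apply_eq, mul_one]
    · simp [Matrix.one_apply_ne hik]
  -- The two terms in the derivative of `g_ij` contribute equally, because `g^{ij}` is symmetric.
  -- The factor `2` cancels the `1/2` in the derivative of `√det g`.
  have hkey : ∑ i, ∑ j, c i j u * fderiv ℝ (fun v => inducedMetric b F v i j) u (b k) =
      2 * ∑ i, ∑ j, c i j u *
        realInner (coordDeriv b j F u) (coordDeriv b k (coordDeriv b i F) u) := by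
    have h1 : ∀ i j, fderiv ℝ (fun v => inducedMetric b F v i j) u (b k) =
        realInner (coordDeriv b j F u) (coordDeriv b k (coordDeriv b i F) u) +
        realInner (coordDeriv b i F u) (coordDeriv b k (coordDeriv b j F) u) := by
      intro i j
      rw [realInner_comm (coordDeriv b j F u)]
      exact fderiv_realInner_apply (hd i) (hd j) (b k)
    simp only [h1, mul_add, Finset.sum_add_distrib, two_mul]
    congr 1
    rw [Finset.sum_comm]
    refine Finset.sum_congr rfl fun i _ => Finset.sum_congr rfl fun j _ => ?_
    simp only [hc]
    rw [inducedMetric_inv_isSymm]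
  rw [coordLaplacian, realInner_smul_left, realInner_sum_left]
  simp only [realInner_sum_left]
  rw [Finset.sum_congr rfl fun i _ => Finset.sum_congr rfl fun j _ => hterm i j]
  simp only [Finset.sum_sub_distrib, hsum, Finset.sum_ite_eq', Finset.mem_univ, if_true]
  rw [fderiv_sqrt_det_apply hF hli]
  change _ * ((1 / 2) * ∑ i, ∑ j, c i j u * _ - _) = 0
  rw [hkey]
  ring

end Submanifolds

/-! ### Coordinate expressions in charts. -/

section Charts

variable {E H M W : Type*} [NormedAddCommGroup E] [NormedSpace ℝ E] [TopologicalSpace H]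
  [TopologicalSpace M] [ChartedSpace H M] {J : ModelWithCorners ℝ E H} {f : M → W}

lemma coordRep_apply_self (p : M) : coordRep J f p (extChartAt J p p) = f p := by
  simp [coordRep]

variable [NormedAddCommGroup W] [InnerProductSpace ℂ W]

lemma ContMDiff.contDiffAt_coordRep [J.Boundaryless] {n : WithTop ℕ∞}
    (hf : ContMDiff J 𝓘(ℝ, W) n f) (p : M) :
    ContDiffAt ℝ n (coordRep J f p) (extChartAt J p p) := by
  have h := (contMDiffAt_iff.mp (hf p)).2
  rw [J.range_eq_univ, contDiffWithinAt_univ] at h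
  exact h

lemma fderiv_coordRep [J.Boundaryless] (hf : ContMDiff J 𝓘(ℝ, W) ∞ f) (p : M) :
    fderiv ℝ (coordRep J f p) (extChartAt J p p) = mfderiv J 𝓘(ℝ, W) f p := by
  have h : MDifferentiableAt J 𝓘(ℝ, W) f p := (hf p).mdifferentiableAt (by simp)
  have h2 := h.hasMFDerivAt.2
  rw [J.range_eq_univ] at h2
  -- An arbitrary `L : E →L[ℝ] W` bridges the tangent spaces, in which `mfderiv` is typed, and the
  -- model spaces.
  have h3 : ∀ L : E →L[ℝ] W, HasFDerivWithinAt (coordRep J f p) L Set.univ (extChartAt J p p) →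
      fderiv ℝ (coordRep J f p) (extChartAt J p p) = L :=
    fun L hL => (hasFDerivWithinAt_univ.mp hL).fderiv
  exact h3 _ h2

end Charts

/-! ### Minimal immersions into the unit sphere. -/

section Minimal

variable {ι E W : Type*} [NormedAddCommGroup E] [NormedSpace ℝ E]
  [NormedAddCommGroup W] [InnerProductSpace ℂ W]
  {b : Module.Basis ι ℝ E} {F : E → W} {u : E}

lemma eq_zero_of_realInner_self {v : W} (h : realInner v v = 0) : v = 0 := by
  rw [realInner_self] at h
  simpa using h

lemma realInner_coordDeriv_of_norm_eq_one (hn : ∀ v, ‖F v‖ = 1) (hF : DifferentiableAt ℝ F u)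
    (i : ι) : realInner (F u) (coordDeriv b i F u) = 0 := by
  have h := fderiv_realInner_apply hF hF (b i)
  simp only [realInner_self, hn] at h
  rw [realInner_comm (fderiv ℝ F u (b i))] at h
  simp only [one_pow, fderiv_fun_const, Pi.zero_apply, zero_apply] at h
  exact add_self_eq_zero.mp h.symm

/-- Differentiate `⟨F, ∂_j F⟩ = 0`, which is already the derivative of `‖F‖² = 1`. -/
lemma realInner_coordDeriv_coordDeriv_of_norm_eq_one (hn : ∀ v, ‖F v‖ = 1)
    (hF : ContDiffAt ℝ 2 F u) (i j : ι) :
    realInner (F u) (coordDeriv b i (coordDeriv b j F) u) = -inducedMetric b F u i j := by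
  have hd : ∀ᶠ v in nhds u, DifferentiableAt ℝ F v :=
    (hF.eventually (by simp)).mono fun v hv => hv.differentiableAt (by norm_num)
  have h0 : (fun v => realInner (F v) (coordDeriv b j F v)) =ᶠ[nhds u] fun _ => 0 :=
    hd.mono fun v hv => realInner_coordDeriv_of_norm_eq_one hn hv j
  have h := fderiv_realInner_apply (hF.differentiableAt (by norm_num))
    ((hF.coordDeriv (b := b) (m := 1) (by norm_num) j).differentiableAt (by norm_num)) (b i)
  rw [h0.fderiv_eq] at h
  simp only [fderiv_fun_const, Pi.zero_apply, zero_apply] at h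
  exact (neg_eq_of_add_eq_zero_right h.symm).symm

variable [Fintype ι] [DecidableEq ι]

/-- Pairing the second derivatives with `F` gives `-g_ij`; contracting with the inverse metric gives
minus the trace of the identity. -/
lemma realInner_traceHessian_of_norm_eq_one (hn : ∀ v, ‖F v‖ = 1)
    (hF : ContDiffAt ℝ 2 F u) (hli : LinearIndependent ℝ fun i => coordDeriv b i F u) :
    realInner (F u) (traceHessian b F u) = -(Fintype.card ι : ℝ) := by
  simp only [traceHessian, realInner_sum_right, realInner_smul_right,
    realInner_coordDeriv_coordDeriv_of_norm_eq_one hn hF]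
  have h := congrArg Matrix.trace (Matrix.nonsing_inv_mul (inducedMetric b F u)
    (isUnit_iff_ne_zero.mpr (inducedMetric_det_pos hli).ne'))
  rw [Matrix.trace_one] at h
  rw [← h, Matrix.trace, ← Finset.sum_neg_distrib]
  refine Finset.sum_congr rfl fun i _ => ?_
  rw [Matrix.diag_apply, Matrix.mul_apply, ← Finset.sum_neg_distrib]
  refine Finset.sum_congr rfl fun j _ => ?_
  rw [inducedMetric_isSymm u j i, mul_neg]

/-- For a minimal immersion into the sphere, `tr_g ∂²F + k F` is tangent. -/
lemma exists_traceHessian_add_eq_of_minimal (hn : ∀ v, ‖F v‖ = 1)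
    (hF : ContDiffAt ℝ 2 F u) (hli : LinearIndependent ℝ fun i => coordDeriv b i F u)
    (hmin : ∀ ν : W, realInner ν (F u) = 0 → (∀ i, realInner ν (coordDeriv b i F u) = 0) →
      realInner ν (traceHessian b F u) = 0) :
    ∃ l : ι → ℝ, traceHessian b F u =
      (-(Fintype.card ι : ℝ)) • F u + ∑ j, l j • coordDeriv b j F u := by
  obtain ⟨l, hl⟩ := coordLaplacian_eq_traceHessian_add hF hli
  have htan : ∀ i, realInner (F u) (coordDeriv b i F u) = 0 :=
    realInner_coordDeriv_of_norm_eq_one hn (hF.differentiableAt (by norm_num))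
  have htr := realInner_traceHessian_of_norm_eq_one hn hF hli
  -- This `ν` is tangent to the sphere and normal to `F`, so minimality applies to it. Since `ν` is
  -- the trace of the Hessian plus vectors orthogonal to `ν`, it is orthogonal to itself.
  set ν := coordLaplacian b (inducedMetric b F) F u + (Fintype.card ι : ℝ) • F u with hν
  have h1 : realInner ν (F u) = 0 := by
    rw [realInner_comm, hν, hl]
    simp only [realInner_add_right, realInner_sum_right, realInner_smul_right, htr, htan,
      realInner_self, hn]
    simp
  have h2 : ∀ i, realInner ν (coordDeriv b i F u) = 0 := fun i => by
    rw [hν, realInner_add_left, realInner_coordLaplacian_coordDeriv hF hli, realInner_smul_left,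
      htan]
    simp
  have h3 : realInner ν ν = 0 := by
    nth_rewrite 2 [hν]
    rw [hl]
    simp only [realInner_add_right, realInner_sum_right, realInner_smul_right, h1, h2,
      hmin ν h1 h2]
    simp
  have h4 := eq_zero_of_realInner_self h3
  refine ⟨fun j => -l j, ?_⟩
  rw [hν, hl] at h4
  simp only [neg_smul, Finset.sum_neg_distrib]
  rw [← sub_eq_zero, ← h4]
  abel

end Minimal

/-! ### First derivatives of a spiral product. -/

section Product

variable {ι₁ ι₂ E₁ E₂ W₁ W₂ : Type*}
  [NormedAddCommGroup E₁] [NormedSpace ℝ E₁] [NormedAddCommGroup E₂] [NormedSpace ℝ E₂]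
  [NormedAddCommGroup W₁] [InnerProductSpace ℂ W₁] [NormedAddCommGroup W₂] [InnerProductSpace ℂ W₂]

/-- The continuous real-linear identification of `W₁ × W₂` with its `L²` version. -/
def toLpL (W₁ W₂ : Type*) [NormedAddCommGroup W₁] [InnerProductSpace ℂ W₁]
    [NormedAddCommGroup W₂] [InnerProductSpace ℂ W₂] : W₁ × W₂ →L[ℝ] WithLp 2 (W₁ × W₂) :=
  ((WithLp.prodContinuousLinearEquiv 2 ℂ W₁ W₂).symm :
    W₁ × W₂ →L[ℂ] WithLp 2 (W₁ × W₂)).restrictScalars ℝ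

lemma toLpL_apply (w : W₁ × W₂) : toLpL W₁ W₂ w = WithLp.toLp 2 w := rfl

lemma realInner_toLpL (v w : W₁ × W₂) :
    realInner (toLpL W₁ W₂ v) (toLpL W₁ W₂ w) = realInner v.1 w.1 + realInner v.2 w.2 := by
  simp [toLpL_apply, realInner]

variable {b₁ : Module.Basis ι₁ ℝ E₁} {b₂ : Module.Basis ι₂ ℝ E₂}
  {A B : ℝ → ℂ} {F₁ : E₁ → W₁} {F₂ : E₂ → W₂} {t : ℝ} {u₁ : E₁} {u₂ : E₂}

lemma hasFDerivAt_spiralProduct {A' B' : ℂ} (hA : HasDerivAt A A' t) (hB : HasDerivAt B B' t)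
    {F₁' : E₁ →L[ℝ] W₁} {F₂' : E₂ →L[ℝ] W₂} (h₁ : HasFDerivAt F₁ F₁' u₁)
    (h₂ : HasFDerivAt F₂ F₂' u₂) (w : ℝ × (E₁ × E₂)) :
    DifferentiableAt ℝ (spiralProduct A B F₁ F₂) (t, (u₁, u₂)) ∧
    fderiv ℝ (spiralProduct A B F₁ F₂) (t, (u₁, u₂)) w =
      toLpL W₁ W₂ ((w.1 : ℂ) • A' • F₁ u₁ + A t • F₁' w.2.1,
        (w.1 : ℂ) • B' • F₂ u₂ + B t • F₂' w.2.2) := by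
  have hA2 := (hA.hasFDerivAt (𝕜 := ℝ)).comp (t, (u₁, u₂)) (hasFDerivAt_fst (𝕜 := ℝ))
  have hB2 := (hB.hasFDerivAt (𝕜 := ℝ)).comp (t, (u₁, u₂)) (hasFDerivAt_fst (𝕜 := ℝ))
  have h₁2 : HasFDerivAt (fun v : ℝ × (E₁ × E₂) => F₁ v.2.1) _ (t, (u₁, u₂)) :=
    HasFDerivAt.comp (t, (u₁, u₂)) h₁
      ((hasFDerivAt_fst (𝕜 := ℝ)).comp (t, (u₁, u₂)) (hasFDerivAt_snd (𝕜 := ℝ)))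
  have h₂2 : HasFDerivAt (fun v : ℝ × (E₁ × E₂) => F₂ v.2.2) _ (t, (u₁, u₂)) :=
    HasFDerivAt.comp (t, (u₁, u₂)) h₂
      ((hasFDerivAt_snd (𝕜 := ℝ)).comp (t, (u₁, u₂)) (hasFDerivAt_snd (𝕜 := ℝ)))
  have h := (toLpL W₁ W₂).hasFDerivAt.comp (t, (u₁, u₂)) ((hA2.smul h₁2).prodMk (hB2.smul h₂2))
  have h' : HasFDerivAt (spiralProduct A B F₁ F₂) _ (t, (u₁, u₂)) := h
  refine ⟨h'.differentiableAt, ?_⟩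
  rw [h'.fderiv]
  simp [add_comm, smul_smul]

lemma ContDiffAt.spiralProduct {n : WithTop ℕ∞} (hA : ContDiffAt ℝ n A t)
    (hB : ContDiffAt ℝ n B t) (h₁ : ContDiffAt ℝ n F₁ u₁) (h₂ : ContDiffAt ℝ n F₂ u₂) :
    ContDiffAt ℝ n (spiralProduct A B F₁ F₂) (t, (u₁, u₂)) := by
  have hA2 : ContDiffAt ℝ n (fun v : ℝ × (E₁ × E₂) => A v.1) (t, (u₁, u₂)) :=
    ContDiffAt.comp (t, (u₁, u₂)) hA contDiffAt_fst
  have hB2 : ContDiffAt ℝ n (fun v : ℝ × (E₁ × E₂) => B v.1) (t, (u₁, u₂)) :=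
    ContDiffAt.comp (t, (u₁, u₂)) hB contDiffAt_fst
  have h₁2 : ContDiffAt ℝ n (fun v : ℝ × (E₁ × E₂) => F₁ v.2.1) (t, (u₁, u₂)) :=
    ContDiffAt.comp (t, (u₁, u₂)) h₁ (contDiffAt_fst.comp _ contDiffAt_snd)
  have h₂2 : ContDiffAt ℝ n (fun v : ℝ × (E₁ × E₂) => F₂ v.2.2) (t, (u₁, u₂)) :=
    ContDiffAt.comp (t, (u₁, u₂)) h₂ (contDiffAt_snd.comp _ contDiffAt_snd)
  exact (toLpL W₁ W₂).contDiff.contDiffAt.comp (t, (u₁, u₂))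
    ((hA2.smul h₁2).prodMk (hB2.smul h₂2))

/-- The basis of `ℝ × E₁ × E₂` built from bases of the factors. -/
abbrev spiralBasis (b₁ : Module.Basis ι₁ ℝ E₁) (b₂ : Module.Basis ι₂ ℝ E₂) :
    Module.Basis (Unit ⊕ (ι₁ ⊕ ι₂)) ℝ (ℝ × (E₁ × E₂)) :=
  (Module.Basis.singleton Unit ℝ).prod (b₁.prod b₂)

/-- Partial derivatives of spiral products are again spiral products, possibly with a zero curve in
one component. The same formulas therefore apply again to give second derivatives. -/
lemma coordDeriv_spiralProduct_time (hA : DifferentiableAt ℝ A t) (hB : DifferentiableAt ℝ B t)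
    (h₁ : DifferentiableAt ℝ F₁ u₁) (h₂ : DifferentiableAt ℝ F₂ u₂) :
    coordDeriv (spiralBasis b₁ b₂) (Sum.inl ()) (spiralProduct A B F₁ F₂) (t, (u₁, u₂)) =
      spiralProduct (deriv A) (deriv B) F₁ F₂ (t, (u₁, u₂)) := by
  rw [coordDeriv, (hasFDerivAt_spiralProduct hA.hasDerivAt hB.hasDerivAt h₁.hasFDerivAt
    h₂.hasFDerivAt _).2]
  simp [Module.Basis.prod_apply, toLpL_apply, spiralProduct]

lemma coordDeriv_spiralProduct_left (hA : DifferentiableAt ℝ A t) (hB : DifferentiableAt ℝ B t)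
    (h₁ : DifferentiableAt ℝ F₁ u₁) (h₂ : DifferentiableAt ℝ F₂ u₂) (i : ι₁) :
    coordDeriv (spiralBasis b₁ b₂) (Sum.inr (Sum.inl i)) (spiralProduct A B F₁ F₂) (t, (u₁, u₂)) =
      spiralProduct A 0 (coordDeriv b₁ i F₁) F₂ (t, (u₁, u₂)) := by
  rw [coordDeriv, (hasFDerivAt_spiralProduct hA.hasDerivAt hB.hasDerivAt h₁.hasFDerivAt
    h₂.hasFDerivAt _).2]
  simp [Module.Basis.prod_apply, toLpL_apply, spiralProduct, coordDeriv]

lemma coordDeriv_spiralProduct_right (hA : DifferentiableAt ℝ A t) (hB : DifferentiableAt ℝ B t)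
    (h₁ : DifferentiableAt ℝ F₁ u₁) (h₂ : DifferentiableAt ℝ F₂ u₂) (i : ι₂) :
    coordDeriv (spiralBasis b₁ b₂) (Sum.inr (Sum.inr i)) (spiralProduct A B F₁ F₂) (t, (u₁, u₂)) =
      spiralProduct 0 B F₁ (coordDeriv b₂ i F₂) (t, (u₁, u₂)) := by
  rw [coordDeriv, (hasFDerivAt_spiralProduct hA.hasDerivAt hB.hasDerivAt h₁.hasFDerivAt
    h₂.hasFDerivAt _).2]
  simp [Module.Basis.prod_apply, toLpL_apply, spiralProduct, coordDeriv]

end Product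

/-! ### Second derivatives of a spiral product. -/

section ProductLaplacian

variable {ι₁ ι₂ E₁ E₂ W₁ W₂ : Type*}
  [NormedAddCommGroup E₁] [NormedSpace ℝ E₁] [NormedAddCommGroup E₂] [NormedSpace ℝ E₂]
  [NormedAddCommGroup W₁] [InnerProductSpace ℂ W₁] [NormedAddCommGroup W₂] [InnerProductSpace ℂ W₂]
  {b₁ : Module.Basis ι₁ ℝ E₁} {b₂ : Module.Basis ι₂ ℝ E₂}
  {A B : ℝ → ℂ} {F₁ : E₁ → W₁} {F₂ : E₂ → W₂} {t : ℝ} {u₁ : E₁} {u₂ : E₂}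

lemma eventually_differentiableAt_factors (hA : ContDiffAt ℝ 2 A t) (hB : ContDiffAt ℝ 2 B t)
    (h₁ : ContDiffAt ℝ 2 F₁ u₁) (h₂ : ContDiffAt ℝ 2 F₂ u₂) :
    ∀ᶠ v in nhds (t, (u₁, u₂)), DifferentiableAt ℝ A v.1 ∧ DifferentiableAt ℝ B v.1 ∧
      DifferentiableAt ℝ F₁ v.2.1 ∧ DifferentiableAt ℝ F₂ v.2.2 := by
  have c0 : Filter.Tendsto (fun v : ℝ × (E₁ × E₂) => v.1) (nhds (t, (u₁, u₂))) (nhds t) :=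
    continuousAt_fst
  have c1 : Filter.Tendsto (fun v : ℝ × (E₁ × E₂) => v.2.1) (nhds (t, (u₁, u₂))) (nhds u₁) :=
    (continuous_fst.comp continuous_snd).continuousAt
  have c2 : Filter.Tendsto (fun v : ℝ × (E₁ × E₂) => v.2.2) (nhds (t, (u₁, u₂))) (nhds u₂) :=
    (continuous_snd.comp continuous_snd).continuousAt
  have hA' : ∀ᶠ y in nhds t, DifferentiableAt ℝ A y :=
    (hA.eventually (by simp)).mono fun v hv => hv.differentiableAt (by norm_num)
  have hB' : ∀ᶠ y in nhds t, DifferentiableAt ℝ B y :=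
    (hB.eventually (by simp)).mono fun v hv => hv.differentiableAt (by norm_num)
  have h₁' : ∀ᶠ y in nhds u₁, DifferentiableAt ℝ F₁ y :=
    (h₁.eventually (by simp)).mono fun v hv => hv.differentiableAt (by norm_num)
  have h₂' : ∀ᶠ y in nhds u₂, DifferentiableAt ℝ F₂ y :=
    (h₂.eventually (by simp)).mono fun v hv => hv.differentiableAt (by norm_num)
  exact (c0.eventually hA').and ((c0.eventually hB').and
    ((c1.eventually h₁').and (c2.eventually h₂')))

lemma coordDeriv_congr {ι E W : Type*} [NormedAddCommGroup E] [NormedSpace ℝ E]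
    [NormedAddCommGroup W] [InnerProductSpace ℂ W] {b : Module.Basis ι ℝ E} {F G : E → W} {u : E}
    (h : F =ᶠ[nhds u] G) (i : ι) : coordDeriv b i F u = coordDeriv b i G u := by
  rw [coordDeriv, coordDeriv, h.fderiv_eq]

lemma ContDiffAt.differentiableAt_deriv {A : ℝ → ℂ} (hA : ContDiffAt ℝ 2 A t) :
    DifferentiableAt ℝ (deriv A) t := by
  have h : DifferentiableAt ℝ (fderiv ℝ A) t :=
    (hA.fderiv_right (m := 1) (by norm_num)).differentiableAt (by norm_num)
  exact h.clm_apply (differentiableAt_const _)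

lemma coordDeriv_spiralProduct_time_time (hA : ContDiffAt ℝ 2 A t) (hB : ContDiffAt ℝ 2 B t)
    (h₁ : ContDiffAt ℝ 2 F₁ u₁) (h₂ : ContDiffAt ℝ 2 F₂ u₂) :
    coordDeriv (spiralBasis b₁ b₂) (Sum.inl ())
      (coordDeriv (spiralBasis b₁ b₂) (Sum.inl ()) (spiralProduct A B F₁ F₂)) (t, (u₁, u₂)) =
      spiralProduct (deriv (deriv A)) (deriv (deriv B)) F₁ F₂ (t, (u₁, u₂)) := by
  rw [coordDeriv_congr (G := spiralProduct (deriv A) (deriv B) F₁ F₂)]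
  · exact coordDeriv_spiralProduct_time hA.differentiableAt_deriv hB.differentiableAt_deriv
      (h₁.differentiableAt (by norm_num)) (h₂.differentiableAt (by norm_num))
  · exact (eventually_differentiableAt_factors hA hB h₁ h₂).mono fun v hv =>
      coordDeriv_spiralProduct_time hv.1 hv.2.1 hv.2.2.1 hv.2.2.2

lemma coordDeriv_spiralProduct_left_left (hA : ContDiffAt ℝ 2 A t) (hB : ContDiffAt ℝ 2 B t)
    (h₁ : ContDiffAt ℝ 2 F₁ u₁) (h₂ : ContDiffAt ℝ 2 F₂ u₂) (i j : ι₁) :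
    coordDeriv (spiralBasis b₁ b₂) (Sum.inr (Sum.inl i))
      (coordDeriv (spiralBasis b₁ b₂) (Sum.inr (Sum.inl j)) (spiralProduct A B F₁ F₂))
        (t, (u₁, u₂)) =
      spiralProduct A 0 (coordDeriv b₁ i (coordDeriv b₁ j F₁)) F₂ (t, (u₁, u₂)) := by
  rw [coordDeriv_congr (G := spiralProduct A 0 (coordDeriv b₁ j F₁) F₂)]
  · exact coordDeriv_spiralProduct_left (hA.differentiableAt (by norm_num))
      (differentiableAt_const _)
      ((h₁.coordDeriv (m := 1) (by norm_num) j).differentiableAt (by norm_num))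
      (h₂.differentiableAt (by norm_num)) i
  · exact (eventually_differentiableAt_factors hA hB h₁ h₂).mono fun v hv =>
      coordDeriv_spiralProduct_left hv.1 hv.2.1 hv.2.2.1 hv.2.2.2 j

lemma coordDeriv_spiralProduct_right_right (hA : ContDiffAt ℝ 2 A t) (hB : ContDiffAt ℝ 2 B t)
    (h₁ : ContDiffAt ℝ 2 F₁ u₁) (h₂ : ContDiffAt ℝ 2 F₂ u₂) (i j : ι₂) :
    coordDeriv (spiralBasis b₁ b₂) (Sum.inr (Sum.inr i))
      (coordDeriv (spiralBasis b₁ b₂) (Sum.inr (Sum.inr j)) (spiralProduct A B F₁ F₂))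
        (t, (u₁, u₂)) =
      spiralProduct 0 B F₁ (coordDeriv b₂ i (coordDeriv b₂ j F₂)) (t, (u₁, u₂)) := by
  rw [coordDeriv_congr (G := spiralProduct 0 B F₁ (coordDeriv b₂ j F₂))]
  · exact coordDeriv_spiralProduct_right (differentiableAt_const _)
      (hB.differentiableAt (by norm_num)) (h₁.differentiableAt (by norm_num))
      ((h₂.coordDeriv (m := 1) (by norm_num) j).differentiableAt (by norm_num)) i
  · exact (eventually_differentiableAt_factors hA hB h₁ h₂).mono fun v hv =>
      coordDeriv_spiralProduct_right hv.1 hv.2.1 hv.2.2.1 hv.2.2.2 j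

/-- Hermitian orthogonality, unlike real orthogonality, survives arbitrary complex scalars. This is
where the `C`-totally real condition enters. -/
lemma realInner_smul_smul_of_inner_eq_zero {W : Type*} [NormedAddCommGroup W]
    [InnerProductSpace ℂ W] {v w : W} (h : inner ℂ v w = 0) (z z' : ℂ) :
    realInner (z • v) (z' • w) = 0 := by
  simp [realInner, h]

lemma realInner_smul_smul_self {W : Type*} [NormedAddCommGroup W]
    [InnerProductSpace ℂ W] (v w : W) (z : ℂ) :
    realInner (z • v) (z • w) = ‖z‖ ^ 2 * realInner v w := by
  simp only [realInner, inner_smul_left, inner_smul_right]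
  rw [← mul_assoc, mul_comm z, ← Complex.normSq_eq_conj_mul_self, Complex.normSq_eq_norm_sq,
    Complex.re_ofReal_mul]

lemma spiralProduct_apply {X₁ X₂ : Type*} {G₁ : X₁ → W₁} {G₂ : X₂ → W₂} (t : ℝ) (x : X₁)
    (y : X₂) :
    spiralProduct A B G₁ G₂ (t, (x, y)) = toLpL W₁ W₂ (A t • G₁ x, B t • G₂ y) := rfl

end ProductLaplacian

/-! ### Metric and trace of the Hessian of a spiral product. -/

section ProductLaplacian

variable {ι₁ ι₂ E₁ E₂ W₁ W₂ : Type*}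
  [NormedAddCommGroup E₁] [NormedSpace ℝ E₁] [NormedAddCommGroup E₂] [NormedSpace ℝ E₂]
  [NormedAddCommGroup W₁] [InnerProductSpace ℂ W₁] [NormedAddCommGroup W₂] [InnerProductSpace ℂ W₂]
  {b₁ : Module.Basis ι₁ ℝ E₁} {b₂ : Module.Basis ι₂ ℝ E₂}
  {A B : ℝ → ℂ} {F₁ : E₁ → W₁} {F₂ : E₂ → W₂} {t : ℝ} {u₁ : E₁} {u₂ : E₂}

lemma realInner_zero_left {W : Type*} [NormedAddCommGroup W] [InnerProductSpace ℂ W] (w : W) :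
    realInner 0 w = 0 := by
  simp [realInner]

lemma realInner_zero_right {W : Type*} [NormedAddCommGroup W] [InnerProductSpace ℂ W] (w : W) :
    realInner w 0 = 0 := by
  simp [realInner]

/-- The metric of a spiral product is block diagonal. -/
lemma inducedMetric_spiralProduct (hA : DifferentiableAt ℝ A t) (hB : DifferentiableAt ℝ B t)
    (h₁ : DifferentiableAt ℝ F₁ u₁) (h₂ : DifferentiableAt ℝ F₂ u₂)
    (hn₁ : ‖F₁ u₁‖ = 1) (hn₂ : ‖F₂ u₂‖ = 1)
    (ho₁ : ∀ i, inner ℂ (F₁ u₁) (coordDeriv b₁ i F₁ u₁) = 0)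
    (ho₂ : ∀ i, inner ℂ (F₂ u₂) (coordDeriv b₂ i F₂ u₂) = 0) :
    inducedMetric (spiralBasis b₁ b₂) (spiralProduct A B F₁ F₂) (t, (u₁, u₂)) =
      Matrix.fromBlocks ((‖deriv A t‖ ^ 2 + ‖deriv B t‖ ^ 2) • 1) 0 0
        (Matrix.fromBlocks (‖A t‖ ^ 2 • inducedMetric b₁ F₁ u₁) 0 0
          (‖B t‖ ^ 2 • inducedMetric b₂ F₂ u₂)) := by
  ext i j
  have hs₁ : realInner (F₁ u₁) (F₁ u₁) = 1 := by rw [realInner_self, hn₁, one_pow]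
  have hs₂ : realInner (F₂ u₂) (F₂ u₂) = 1 := by rw [realInner_self, hn₂, one_pow]
  have hr₁ : ∀ (z z' : ℂ) i, realInner (z • coordDeriv b₁ i F₁ u₁) (z' • F₁ u₁) = 0 :=
    fun z z' i => by rw [realInner_comm, realInner_smul_smul_of_inner_eq_zero (ho₁ i)]
  have hr₂ : ∀ (z z' : ℂ) i, realInner (z • coordDeriv b₂ i F₂ u₂) (z' • F₂ u₂) = 0 :=
    fun z z' i => by rw [realInner_comm, realInner_smul_smul_of_inner_eq_zero (ho₂ i)]
  rcases i with i | i | i <;> rcases j with j | j | j <;>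
  simp only [inducedMetric, Matrix.of_apply, coordDeriv_spiralProduct_time hA hB h₁ h₂,
    coordDeriv_spiralProduct_left hA hB h₁ h₂, coordDeriv_spiralProduct_right hA hB h₁ h₂,
    spiralProduct_apply, realInner_toLpL, realInner_smul_smul_self, hs₁, hs₂,
    realInner_smul_smul_of_inner_eq_zero (ho₁ _), realInner_smul_smul_of_inner_eq_zero (ho₂ _),
    hr₁, hr₂, Pi.zero_apply, zero_smul, realInner_zero_left, realInner_zero_right] <;>
  simp

variable [Fintype ι₁] [Fintype ι₂]

/-- The time coefficient is the only one common to both components; it becomes the real factor `l`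
of the curve equation. -/
lemma sum_coordDeriv_spiralProduct (hA : DifferentiableAt ℝ A t) (hB : DifferentiableAt ℝ B t)
    (h₁ : DifferentiableAt ℝ F₁ u₁) (h₂ : DifferentiableAt ℝ F₂ u₂)
    (m : Unit ⊕ (ι₁ ⊕ ι₂) → ℝ) :
    ∑ j, m j • coordDeriv (spiralBasis b₁ b₂) j (spiralProduct A B F₁ F₂) (t, (u₁, u₂)) =
      toLpL W₁ W₂ (
        ((m (Sum.inl ()) : ℂ) * deriv A t) • F₁ u₁ +
          A t • ∑ i, m (Sum.inr (Sum.inl i)) • coordDeriv b₁ i F₁ u₁,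
        ((m (Sum.inl ()) : ℂ) * deriv B t) • F₂ u₂ +
          B t • ∑ i, m (Sum.inr (Sum.inr i)) • coordDeriv b₂ i F₂ u₂) := by
  simp only [Fintype.sum_sum_type, coordDeriv_spiralProduct_time hA hB h₁ h₂,
    coordDeriv_spiralProduct_left hA hB h₁ h₂, coordDeriv_spiralProduct_right hA hB h₁ h₂,
    spiralProduct_apply, ← map_smul, ← map_sum, ← map_add, Finset.univ_unique,
    Finset.sum_singleton]
  congr 1
  ext
  · simp [Prod.fst_sum, Finset.smul_sum, mul_smul, Complex.coe_smul, smul_comm (A t)]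
  · simp [Prod.snd_sum, Finset.smul_sum, mul_smul, Complex.coe_smul, smul_comm (B t)]

variable [DecidableEq ι₁] [DecidableEq ι₂]

/-- A right inverse serves twice: it identifies the inverse metric, and it shows that the Gram
determinant is nonzero, so that the product is an immersion. -/
lemma inv_fromBlocks_smul {s a c : ℝ} (hs : s ≠ 0) (ha : a ≠ 0) (hc : c ≠ 0)
    {g₁ : Matrix ι₁ ι₁ ℝ} {g₂ : Matrix ι₂ ι₂ ℝ} (hg₁ : g₁.det ≠ 0) (hg₂ : g₂.det ≠ 0) :
    Matrix.fromBlocks (s • (1 : Matrix Unit Unit ℝ)) 0 0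
      (Matrix.fromBlocks (a • g₁) 0 0 (c • g₂)) *
    Matrix.fromBlocks (s⁻¹ • (1 : Matrix Unit Unit ℝ)) 0 0
      (Matrix.fromBlocks (a⁻¹ • g₁⁻¹) 0 0 (c⁻¹ • g₂⁻¹)) = 1 := by
  simp [Matrix.fromBlocks_multiply, smul_smul, hs, ha, hc,
    Matrix.mul_nonsing_inv g₁ (isUnit_iff_ne_zero.mpr hg₁),
    Matrix.mul_nonsing_inv g₂ (isUnit_iff_ne_zero.mpr hg₂)]

/-- The inverse metric is block diagonal, so mixed second derivatives never contribute. -/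
lemma traceHessian_spiralProduct (hA : ContDiffAt ℝ 2 A t) (hB : ContDiffAt ℝ 2 B t)
    (h₁ : ContDiffAt ℝ 2 F₁ u₁) (h₂ : ContDiffAt ℝ 2 F₂ u₂)
    {s : ℝ} (hinv : (inducedMetric (spiralBasis b₁ b₂) (spiralProduct A B F₁ F₂) (t, (u₁, u₂)))⁻¹ =
      Matrix.fromBlocks (s⁻¹ • (1 : Matrix Unit Unit ℝ)) 0 0
      (Matrix.fromBlocks ((‖A t‖ ^ 2)⁻¹ • (inducedMetric b₁ F₁ u₁)⁻¹) 0 0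
        ((‖B t‖ ^ 2)⁻¹ • (inducedMetric b₂ F₂ u₂)⁻¹))) :
    traceHessian (spiralBasis b₁ b₂) (spiralProduct A B F₁ F₂) (t, (u₁, u₂)) =
      toLpL W₁ W₂ (
        (((s⁻¹ : ℝ) : ℂ) * deriv (deriv A) t) • F₁ u₁ +
          ((((‖A t‖ ^ 2)⁻¹ : ℝ) : ℂ) * A t) • traceHessian b₁ F₁ u₁,
        (((s⁻¹ : ℝ) : ℂ) * deriv (deriv B) t) • F₂ u₂ +
          ((((‖B t‖ ^ 2)⁻¹ : ℝ) : ℂ) * B t) • traceHessian b₂ F₂ u₂) := by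
  simp only [traceHessian, hinv, Fintype.sum_sum_type, Matrix.fromBlocks_apply₁₁,
    Matrix.fromBlocks_apply₁₂, Matrix.fromBlocks_apply₂₁, Matrix.fromBlocks_apply₂₂,
    Matrix.zero_apply, Matrix.smul_apply, zero_smul, Finset.sum_const_zero, add_zero, zero_add,
    Finset.univ_unique, Finset.sum_singleton, PUnit.default_eq_unit, Matrix.one_apply_eq,
    coordDeriv_spiralProduct_time_time hA hB h₁ h₂,
    coordDeriv_spiralProduct_left_left hA hB h₁ h₂,
    coordDeriv_spiralProduct_right_right hA hB h₁ h₂,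
    spiralProduct_apply, ← map_smul, ← map_sum, ← map_add]
  congr 1
  simp only [mul_smul, Complex.coe_smul]
  ext
  · simp [Prod.fst_sum, Finset.smul_sum, mul_smul, smul_comm (A t)]
  · simp [Prod.snd_sum, Finset.smul_sum, mul_smul, smul_comm (B t)]

end ProductLaplacian

/-! ### Reduction of the eigenvalue equation to the curve. -/

section ProductLaplacian

variable {ι₁ ι₂ E₁ E₂ W₁ W₂ : Type*} [Fintype ι₁] [DecidableEq ι₁] [Fintype ι₂] [DecidableEq ι₂]
  [NormedAddCommGroup E₁] [NormedSpace ℝ E₁] [NormedAddCommGroup E₂] [NormedSpace ℝ E₂]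
  [NormedAddCommGroup W₁] [InnerProductSpace ℂ W₁] [NormedAddCommGroup W₂] [InnerProductSpace ℂ W₂]
  {b₁ : Module.Basis ι₁ ℝ E₁} {b₂ : Module.Basis ι₂ ℝ E₂}
  {A B : ℝ → ℂ} {F₁ : E₁ → W₁} {F₂ : E₂ → W₂} {t : ℝ} {u₁ : E₁} {u₂ : E₂}

/-- If the position vector is normal to an immersion `F`, then `F` is an eigenfunction of its
Laplacian as soon as this holds for the trace of the Hessian up to tangent vectors. -/
lemma coordLaplacian_eq_smul_iff {ι E W : Type*} [Fintype ι] [DecidableEq ι]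
    [NormedAddCommGroup E] [NormedSpace ℝ E] [NormedAddCommGroup W] [InnerProductSpace ℂ W]
    {b : Module.Basis ι ℝ E} {F : E → W} {u : E} (hF : ContDiffAt ℝ 2 F u)
    (hli : LinearIndependent ℝ fun i => coordDeriv b i F u)
    (hpos : ∀ i, realInner (F u) (coordDeriv b i F u) = 0) (N : ℝ) :
    coordLaplacian b (inducedMetric b F) F u = (-N) • F u ↔
      ∃ m : ι → ℝ, traceHessian b F u + N • F u = ∑ j, m j • coordDeriv b j F u := by
  obtain ⟨l, hl⟩ := coordLaplacian_eq_traceHessian_add hF hli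
  constructor
  · intro h
    refine ⟨fun j => -l j, ?_⟩
    rw [hl, neg_smul] at h
    simp only [neg_smul, Finset.sum_neg_distrib]
    rw [eq_neg_iff_add_eq_zero] at h
    rw [eq_neg_iff_add_eq_zero, ← h]
    abel
  · rintro ⟨m, hm⟩
    -- `Y` is both tangent and normal, hence zero.
    set Y := coordLaplacian b (inducedMetric b F) F u + N • F u with hY
    have h1 : Y = ∑ j, (m j + l j) • coordDeriv b j F u := by
      simp only [add_smul, Finset.sum_add_distrib]
      rw [← hm, hY, hl]
      abel
    have h2 : ∀ i, realInner Y (coordDeriv b i F u) = 0 := fun i => by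
      rw [hY, realInner_add_left, realInner_coordLaplacian_coordDeriv hF hli, realInner_smul_left,
        hpos]
      simp
    have h3 : realInner Y Y = 0 := by
      nth_rewrite 2 [h1]
      simp [realInner_sum_right, realInner_smul_right, h2]
    rw [neg_smul, eq_neg_iff_add_eq_zero]
    exact eq_zero_of_realInner_self h3

lemma inner_sum_smul_eq_zero {ι W : Type*} [Fintype ι] [NormedAddCommGroup W]
    [InnerProductSpace ℂ W] {w : W} {v : ι → W} (h : ∀ i, inner ℂ w (v i) = 0) (m : ι → ℝ) :
    inner ℂ w (∑ i, m i • v i) = 0 := by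
  rw [inner_sum]
  refine Finset.sum_eq_zero fun i _ => ?_
  rw [← Complex.coe_smul, inner_smul_right, h, mul_zero]

/-- The Hermitian product with the unit vector `w` isolates its coefficient. -/
lemma coeff_eq_of_smul_add_eq {W : Type*} [NormedAddCommGroup W]
    [InnerProductSpace ℂ W] {w v v' : W} (hw : ‖w‖ = 1) (h : inner ℂ w v = 0)
    (h' : inner ℂ w v' = 0) {z z' : ℂ} (e : z • w + v = z' • w + v') : z = z' := by
  have h2 := congrArg (inner ℂ w) e
  rw [inner_add_right, inner_add_right, h, h', inner_smul_right, inner_smul_right,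
    inner_self_eq_norm_sq_to_K, hw] at h2
  simpa using h2

/-- The eigenvalue equation for a spiral product is equivalent to an equation for the curve. -/
theorem coordLaplacian_spiralProduct_iff (hA : ContDiffAt ℝ 2 A t) (hB : ContDiffAt ℝ 2 B t)
    (h₁ : ContDiffAt ℝ 2 F₁ u₁) (h₂ : ContDiffAt ℝ 2 F₂ u₂)
    (hn₁ : ‖F₁ u₁‖ = 1) (hn₂ : ‖F₂ u₂‖ = 1)
    (ho₁ : ∀ i, inner ℂ (F₁ u₁) (coordDeriv b₁ i F₁ u₁) = 0)
    (ho₂ : ∀ i, inner ℂ (F₂ u₂) (coordDeriv b₂ i F₂ u₂) = 0)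
    (hli₁ : LinearIndependent ℝ fun i => coordDeriv b₁ i F₁ u₁)
    (hli₂ : LinearIndependent ℝ fun i => coordDeriv b₂ i F₂ u₂)
    {κ₁ κ₂ : ℝ}
    (hm₁ : ∃ l : ι₁ → ℝ, traceHessian b₁ F₁ u₁ = (-κ₁) • F₁ u₁ + ∑ j, l j • coordDeriv b₁ j F₁ u₁)
    (hm₂ : ∃ l : ι₂ → ℝ, traceHessian b₂ F₂ u₂ = (-κ₂) • F₂ u₂ + ∑ j, l j • coordDeriv b₂ j F₂ u₂)
    (hA0 : A t ≠ 0) (hB0 : B t ≠ 0) (himm : deriv A t ≠ 0 ∨ deriv B t ≠ 0)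
    (hsph : realInner (A t) (deriv A t) + realInner (B t) (deriv B t) = 0) (N : ℝ) :
    coordLaplacian (spiralBasis b₁ b₂)
      (inducedMetric (spiralBasis b₁ b₂) (spiralProduct A B F₁ F₂))
      (spiralProduct A B F₁ F₂) (t, (u₁, u₂)) =
        (-N) • spiralProduct A B F₁ F₂ (t, (u₁, u₂)) ↔
    ∃ l : ℝ,
      (((‖deriv A t‖ ^ 2 + ‖deriv B t‖ ^ 2)⁻¹ : ℝ) : ℂ) * deriv (deriv A) t +
        ((N - κ₁ / ‖A t‖ ^ 2 : ℝ) : ℂ) * A t = l * deriv A t ∧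
      (((‖deriv A t‖ ^ 2 + ‖deriv B t‖ ^ 2)⁻¹ : ℝ) : ℂ) * deriv (deriv B) t +
        ((N - κ₂ / ‖B t‖ ^ 2 : ℝ) : ℂ) * B t = l * deriv B t := by
  have dA : DifferentiableAt ℝ A t := hA.differentiableAt (by norm_num)
  have dB : DifferentiableAt ℝ B t := hB.differentiableAt (by norm_num)
  have d₁ : DifferentiableAt ℝ F₁ u₁ := h₁.differentiableAt (by norm_num)
  have d₂ : DifferentiableAt ℝ F₂ u₂ := h₂.differentiableAt (by norm_num)
  have hs : ‖deriv A t‖ ^ 2 + ‖deriv B t‖ ^ 2 ≠ 0 := by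
    rcases himm with h | h
    · have := norm_pos_iff.mpr h
      positivity
    · have := norm_pos_iff.mpr h
      positivity
  have hmet := inducedMetric_spiralProduct dA dB d₁ d₂ hn₁ hn₂ ho₁ ho₂
  have hmul := inv_fromBlocks_smul hs (pow_ne_zero 2 (norm_ne_zero_iff.mpr hA0))
    (pow_ne_zero 2 (norm_ne_zero_iff.mpr hB0)) (inducedMetric_det_pos hli₁).ne'
    (inducedMetric_det_pos hli₂).ne'
  rw [← hmet] at hmul
  have hinv := Matrix.inv_eq_right_inv hmul
  have hli : LinearIndependent ℝ fun i =>
      coordDeriv (spiralBasis b₁ b₂) i (spiralProduct A B F₁ F₂) (t, (u₁, u₂)) := by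
    let _ : InnerProductSpace ℝ (WithLp 2 (W₁ × W₂)) :=
      InnerProductSpace.rclikeToReal ℂ (WithLp 2 (W₁ × W₂))
    refine Matrix.linearIndependent_of_det_gram_ne_zero (𝕜 := ℝ) ?_
    exact (Matrix.isUnit_det_of_right_inverse hmul).ne_zero
  have hpos : ∀ i, realInner (spiralProduct A B F₁ F₂ (t, (u₁, u₂)))
      (coordDeriv (spiralBasis b₁ b₂) i (spiralProduct A B F₁ F₂) (t, (u₁, u₂))) = 0 := by
    rintro (i | i | i)
    · rw [coordDeriv_spiralProduct_time dA dB d₁ d₂, spiralProduct_apply, spiralProduct_apply,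
        realInner_toLpL, ← hsph]
      simp only [realInner, inner_smul_left, inner_smul_right, inner_self_eq_norm_sq_to_K, hn₁, hn₂]
      simp [mul_comm]
    · rw [coordDeriv_spiralProduct_left dA dB d₁ d₂, spiralProduct_apply, spiralProduct_apply,
        realInner_toLpL]
      simp [realInner_smul_smul_of_inner_eq_zero (ho₁ _), realInner_zero_right]
    · rw [coordDeriv_spiralProduct_right dA dB d₁ d₂, spiralProduct_apply, spiralProduct_apply,
        realInner_toLpL]
      simp [realInner_smul_smul_of_inner_eq_zero (ho₂ _), realInner_zero_right]
  rw [coordLaplacian_eq_smul_iff (hA.spiralProduct hB h₁ h₂) hli hpos,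
    traceHessian_spiralProduct hA hB h₁ h₂ hinv]
  obtain ⟨l₁, hl₁⟩ := hm₁
  obtain ⟨l₂, hl₂⟩ := hm₂
  simp only [sum_coordDeriv_spiralProduct dA dB d₁ d₂, spiralProduct_apply, ← map_smul, ← map_add]
  have hinj : Function.Injective (toLpL W₁ W₂) := fun v w h => WithLp.toLp_injective 2 h
  simp only [hinj.eq_iff, Prod.ext_iff, Prod.smul_mk, Prod.mk_add_mk]
  set s := ‖deriv A t‖ ^ 2 + ‖deriv B t‖ ^ 2
  -- Minimality of the factor turns the trace of its Hessian into `-κ₁ F₁` plus tangent vectors,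
  -- which are collected in the last sum.
  have e₁ : (((s⁻¹ : ℝ) : ℂ) * deriv (deriv A) t) • F₁ u₁ +
      ((((‖A t‖ ^ 2)⁻¹ : ℝ) : ℂ) * A t) • traceHessian b₁ F₁ u₁ + N • A t • F₁ u₁ =
      (((s⁻¹ : ℝ) : ℂ) * deriv (deriv A) t + ((N - κ₁ / ‖A t‖ ^ 2 : ℝ) : ℂ) * A t) • F₁ u₁ +
        A t • ∑ i, ((‖A t‖ ^ 2)⁻¹ * l₁ i) • coordDeriv b₁ i F₁ u₁ := by
    rw [hl₁]
    simp only [mul_smul _ (l₁ _), ← Finset.smul_sum]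
    simp only [← Complex.coe_smul (_ : ℝ) (_ : W₁), div_eq_mul_inv, Complex.ofReal_sub,
      Complex.ofReal_mul, Complex.ofReal_neg]
    module
  have e₂ : (((s⁻¹ : ℝ) : ℂ) * deriv (deriv B) t) • F₂ u₂ +
      ((((‖B t‖ ^ 2)⁻¹ : ℝ) : ℂ) * B t) • traceHessian b₂ F₂ u₂ + N • B t • F₂ u₂ =
      (((s⁻¹ : ℝ) : ℂ) * deriv (deriv B) t + ((N - κ₂ / ‖B t‖ ^ 2 : ℝ) : ℂ) * B t) • F₂ u₂ +
        B t • ∑ i, ((‖B t‖ ^ 2)⁻¹ * l₂ i) • coordDeriv b₂ i F₂ u₂ := by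
    rw [hl₂]
    simp only [mul_smul _ (l₂ _), ← Finset.smul_sum]
    simp only [← Complex.coe_smul (_ : ℝ) (_ : W₂), div_eq_mul_inv, Complex.ofReal_sub,
      Complex.ofReal_mul, Complex.ofReal_neg]
    module
  rw [e₁, e₂]
  have z₁ : ∀ (z : ℂ) (m : ι₁ → ℝ), inner ℂ (F₁ u₁) (z • ∑ i, m i • coordDeriv b₁ i F₁ u₁) = 0 :=
    fun z m => by rw [inner_smul_right, inner_sum_smul_eq_zero ho₁, mul_zero]
  have z₂ : ∀ (z : ℂ) (m : ι₂ → ℝ), inner ℂ (F₂ u₂) (z • ∑ i, m i • coordDeriv b₂ i F₂ u₂) = 0 :=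
    fun z m => by rw [inner_smul_right, inner_sum_smul_eq_zero ho₂, mul_zero]
  constructor
  · rintro ⟨m, hm₁, hm₂⟩
    exact ⟨m (Sum.inl ()), coeff_eq_of_smul_add_eq hn₁ (z₁ _ _) (z₁ _ _) hm₁,
      coeff_eq_of_smul_add_eq hn₂ (z₂ _ _) (z₂ _ _) hm₂⟩
  · rintro ⟨l, hl, hl'⟩
    -- The factor directions must absorb exactly the tangent sums in `e₁` and `e₂`.
    exact ⟨Sum.elim (fun _ => l) (Sum.elim (fun i => (‖A t‖ ^ 2)⁻¹ * l₁ i)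
      (fun i => (‖B t‖ ^ 2)⁻¹ * l₂ i)), by rw [hl]; rfl, by rw [hl']; rfl⟩

end ProductLaplacian

/-- The second order equation satisfied at time `t` by a curve `(γ₁, γ₂)` generating a spiral
minimal product: its two components are proportional to the velocity, with the same real factor. -/
def SpiralEquation (k₁ k₂ : ℕ) (γ₁ γ₂ : ℝ → ℂ) (t : ℝ) : Prop :=
  ∃ l : ℝ,
    (((‖deriv γ₁ t‖ ^ 2 + ‖deriv γ₂ t‖ ^ 2)⁻¹ : ℝ) : ℂ) * deriv (deriv γ₁) t +
      (((k₁ + k₂ + 1) - k₁ / ‖γ₁ t‖ ^ 2 : ℝ) : ℂ) * γ₁ t = l * deriv γ₁ t ∧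
    (((‖deriv γ₁ t‖ ^ 2 + ‖deriv γ₂ t‖ ^ 2)⁻¹ : ℝ) : ℂ) * deriv (deriv γ₂) t +
      (((k₁ + k₂ + 1) - k₂ / ‖γ₂ t‖ ^ 2 : ℝ) : ℂ) * γ₂ t = l * deriv γ₂ t

/-! ### The factors in their charts. -/

section Factor

variable {k : ℕ} {W L : Type*} [NormedAddCommGroup W] [InnerProductSpace ℂ W]
  [TopologicalSpace L] [ChartedSpace (EuclideanSpace ℝ (Fin k)) L] {f : L → W}

lemma IsMinimalImmersionInSphere.linearIndependent
    (hf : IsMinimalImmersionInSphere (𝓡 k) (stdBasis k) f) (x : L) :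
    LinearIndependent ℝ fun i =>
      coordDeriv (stdBasis k) i (coordRep (𝓡 k) f x) (extChartAt (𝓡 k) x x) := by
  have hinj : Function.Injective (fderiv ℝ (coordRep (𝓡 k) f x) (extChartAt (𝓡 k) x x)) := by
    rw [fderiv_coordRep hf.smooth x]
    exact hf.immersion x
  exact (stdBasis k).linearIndependent.map'
    (fderiv ℝ (coordRep (𝓡 k) f x) (extChartAt (𝓡 k) x x)).toLinearMap
    (LinearMap.ker_eq_bot.mpr hinj)

lemma IsMinimalImmersionInSphere.contDiffAt
    (hf : IsMinimalImmersionInSphere (𝓡 k) (stdBasis k) f) (x : L) :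
    ContDiffAt ℝ 2 (coordRep (𝓡 k) f x) (extChartAt (𝓡 k) x x) :=
  (hf.smooth.contDiffAt_coordRep x).of_le (by norm_cast)

lemma IsMinimalImmersionInSphere.norm_coordRep
    (hf : IsMinimalImmersionInSphere (𝓡 k) (stdBasis k) f) (x : L) (v) :
    ‖coordRep (𝓡 k) f x v‖ = 1 := hf.norm_eq_one _

/-- The real part vanishes because the norm is constant, the imaginary part because `f` is
`C`-totally real. -/
lemma IsMinimalImmersionInSphere.inner_coordDeriv
    (hf : IsMinimalImmersionInSphere (𝓡 k) (stdBasis k) f) (hc : IsCTotallyReal (𝓡 k) f) (x : L)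
    (i : Fin k) :
    inner ℂ (coordRep (𝓡 k) f x (extChartAt (𝓡 k) x x))
      (coordDeriv (stdBasis k) i (coordRep (𝓡 k) f x) (extChartAt (𝓡 k) x x)) = 0 := by
  apply Complex.ext
  · exact realInner_coordDeriv_of_norm_eq_one (hf.norm_coordRep x)
      ((hf.contDiffAt x).differentiableAt (by norm_num)) i
  · have h : realInner (Complex.I • f x)
        (coordDeriv (stdBasis k) i (coordRep (𝓡 k) f x) (extChartAt (𝓡 k) x x)) = 0 := by
      rw [coordDeriv, fderiv_coordRep hf.smooth x]
      exact hc x _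
    rw [coordRep_apply_self]
    rw [realInner, inner_smul_left] at h
    simpa using h

lemma IsMinimalImmersionInSphere.exists_traceHessian
    (hf : IsMinimalImmersionInSphere (𝓡 k) (stdBasis k) f) (x : L) :
    ∃ l : Fin k → ℝ, traceHessian (stdBasis k) (coordRep (𝓡 k) f x) (extChartAt (𝓡 k) x x) =
      (-(k : ℝ)) • coordRep (𝓡 k) f x (extChartAt (𝓡 k) x x) +
        ∑ j, l j • coordDeriv (stdBasis k) j (coordRep (𝓡 k) f x) (extChartAt (𝓡 k) x x) := by
  have h := exists_traceHessian_add_eq_of_minimal (b := stdBasis k) (hf.norm_coordRep x)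
    (hf.contDiffAt x) (hf.linearIndependent x) (by
      intro ν h1 h2
      rw [coordRep_apply_self] at h1
      exact hf.minimal x ν h1 h2)
  rwa [Fintype.card_fin] at h

end Factor

/-- The Laplace equation for a spiral product is equivalent to an equation for the curve. -/
theorem inducedLaplacian_spiralProduct_iff {k₁ k₂ : ℕ} {W₁ W₂ L₁ L₂ : Type*}
    [NormedAddCommGroup W₁] [InnerProductSpace ℂ W₁]
    [NormedAddCommGroup W₂] [InnerProductSpace ℂ W₂]
    [TopologicalSpace L₁] [ChartedSpace (EuclideanSpace ℝ (Fin k₁)) L₁]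
    [TopologicalSpace L₂] [ChartedSpace (EuclideanSpace ℝ (Fin k₂)) L₂]
    {f₁ : L₁ → W₁} {f₂ : L₂ → W₂}
    (hf₁ : IsMinimalImmersionInSphere (𝓡 k₁) (stdBasis k₁) f₁)
    (hf₂ : IsMinimalImmersionInSphere (𝓡 k₂) (stdBasis k₂) f₂)
    (hc₁ : IsCTotallyReal (𝓡 k₁) f₁) (hc₂ : IsCTotallyReal (𝓡 k₂) f₂)
    {T : Set ℝ} (hTo : IsOpen T) {γ₁ γ₂ : ℝ → ℂ} (hγ : IsImmersedCurveInSphere T γ₁ γ₂)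
    (hγ0 : ∀ t ∈ T, γ₁ t * γ₂ t ≠ 0) {t : ℝ} (ht : t ∈ T) (x : L₁) (y : L₂) :
    inducedLaplacian (𝓘(ℝ, ℝ).prod ((𝓡 k₁).prod (𝓡 k₂))) (prodBasis k₁ k₂)
          (spiralProduct γ₁ γ₂ f₁ f₂) (t, (x, y)) =
        (-((k₁ : ℝ) + k₂ + 1)) • spiralProduct γ₁ γ₂ f₁ f₂ (t, (x, y)) ↔
      SpiralEquation k₁ k₂ γ₁ γ₂ t := by
  have hA := hγ.contDiff_fst.contDiffAt (hTo.mem_nhds ht)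
  have hB := hγ.contDiff_snd.contDiffAt (hTo.mem_nhds ht)
  have hsph : realInner (γ₁ t) (deriv γ₁ t) + realInner (γ₂ t) (deriv γ₂ t) = 0 := by
    have dA : DifferentiableAt ℝ γ₁ t := hA.differentiableAt (by norm_num)
    have dB : DifferentiableAt ℝ γ₂ t := hB.differentiableAt (by norm_num)
    have h1 : (fun τ => ‖γ₁ τ‖ ^ 2 + ‖γ₂ τ‖ ^ 2) =ᶠ[nhds t] fun _ => 1 :=
      Filter.eventually_of_mem (hTo.mem_nhds ht) hγ.mem_sphere
    have h2 := (dA.hasDerivAt.norm_sq.add dB.hasDerivAt.norm_sq).deriv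
    have h3 : deriv (fun τ => ‖γ₁ τ‖ ^ 2 + ‖γ₂ τ‖ ^ 2) t = _ := h2
    rw [h1.deriv_eq, deriv_const, ← mul_add] at h3
    have h4 := (mul_eq_zero.mp h3.symm).resolve_left (by norm_num)
    exact h4
  -- The chart of the product is the product of the charts, with the identity on `ℝ`. Hence the
  -- coordinate expression is again a spiral product.
  have hext : extChartAt (𝓘(ℝ, ℝ).prod ((𝓡 k₁).prod (𝓡 k₂))) (t, (x, y)) =
      (PartialEquiv.refl ℝ).prod ((extChartAt (𝓡 k₁) x).prod (extChartAt (𝓡 k₂) y)) := by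
    rw [extChartAt_prod, extChartAt_prod, extChartAt_model_space_eq_id]
  have hrep : coordRep (𝓘(ℝ, ℝ).prod ((𝓡 k₁).prod (𝓡 k₂))) (spiralProduct γ₁ γ₂ f₁ f₂)
      (t, (x, y)) = spiralProduct γ₁ γ₂ (coordRep (𝓡 k₁) f₁ x) (coordRep (𝓡 k₂) f₂ y) := by
    funext v
    rw [coordRep, hext]
    rfl
  have hpt : extChartAt (𝓘(ℝ, ℝ).prod ((𝓡 k₁).prod (𝓡 k₂))) (t, (x, y)) (t, (x, y)) =
      (t, (extChartAt (𝓡 k₁) x x, extChartAt (𝓡 k₂) y y)) := by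
    rw [hext]
    rfl
  have hval : spiralProduct γ₁ γ₂ f₁ f₂ (t, (x, y)) =
      spiralProduct γ₁ γ₂ (coordRep (𝓡 k₁) f₁ x) (coordRep (𝓡 k₂) f₂ y)
        (t, (extChartAt (𝓡 k₁) x x, extChartAt (𝓡 k₂) y y)) := by
    simp only [spiralProduct, coordRep_apply_self]
  rw [inducedLaplacian, hrep, hpt, hval]
  exact coordLaplacian_spiralProduct_iff (b₁ := stdBasis k₁) (b₂ := stdBasis k₂) hA hB
    (hf₁.contDiffAt x) (hf₂.contDiffAt y) (hf₁.norm_coordRep x _) (hf₂.norm_coordRep y _)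
    (hf₁.inner_coordDeriv hc₁ x) (hf₂.inner_coordDeriv hc₂ y)
    (hf₁.linearIndependent x) (hf₂.linearIndependent y)
    (hf₁.exists_traceHessian x) (hf₂.exists_traceHessian y)
    (left_ne_zero_of_mul (hγ0 t ht)) (right_ne_zero_of_mul (hγ0 t ht)) (hγ.immersed t ht)
    hsph ((k₁ : ℝ) + k₂ + 1)

/-! ### Polar coordinates: derivatives and algebra. -/

section Polar

/-- The first and second derivatives of a complex curve `ρ e^{iθ}`. -/
lemma deriv_polar {g : ℝ → ℂ} {ρ θ : ℝ → ℝ} {T : Set ℝ} (hT : IsOpen T)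
    (hρ : ContDiffOn ℝ 2 ρ T) (hθ : ContDiffOn ℝ 2 θ T)
    (h : ∀ t ∈ T, g t = (ρ t : ℂ) * Complex.exp ((θ t : ℂ) * Complex.I)) {t : ℝ} (ht : t ∈ T) :
    deriv g t = (((deriv ρ t : ℝ) : ℂ) + (ρ t * deriv θ t : ℝ) * Complex.I) *
      Complex.exp ((θ t : ℂ) * Complex.I) ∧
    deriv (deriv g) t = ((deriv (deriv ρ) t - ρ t * deriv θ t ^ 2 : ℝ) +
      (2 * deriv ρ t * deriv θ t + ρ t * deriv (deriv θ) t : ℝ) * Complex.I) *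
      Complex.exp ((θ t : ℂ) * Complex.I) := by
  have dρ : ∀ τ ∈ T, HasDerivAt ρ (deriv ρ τ) τ := fun τ hτ =>
    ((hρ.contDiffAt (hT.mem_nhds hτ)).differentiableAt (by norm_num)).hasDerivAt
  have dθ : ∀ τ ∈ T, HasDerivAt θ (deriv θ τ) τ := fun τ hτ =>
    ((hθ.contDiffAt (hT.mem_nhds hτ)).differentiableAt (by norm_num)).hasDerivAt
  have dρ' : HasDerivAt (deriv ρ) (deriv (deriv ρ) t) t :=
    (((hρ.deriv_of_isOpen hT (m := 1) (by norm_num)).contDiffAt (hT.mem_nhds ht)).differentiableAt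
      (by norm_num)).hasDerivAt
  have dθ' : HasDerivAt (deriv θ) (deriv (deriv θ) t) t :=
    (((hθ.deriv_of_isOpen hT (m := 1) (by norm_num)).contDiffAt (hT.mem_nhds ht)).differentiableAt
      (by norm_num)).hasDerivAt
  have de : ∀ τ ∈ T, HasDerivAt (fun t => Complex.exp ((θ t : ℂ) * Complex.I))
      (Complex.exp ((θ τ : ℂ) * Complex.I) * (((deriv θ τ : ℝ) : ℂ) * Complex.I)) τ := fun τ hτ =>
    ((dθ τ hτ).ofReal_comp.mul_const Complex.I).cexp
  have h1 : ∀ τ ∈ T, deriv g τ = (((deriv ρ τ : ℝ) : ℂ) + (ρ τ * deriv θ τ : ℝ) * Complex.I) *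
      Complex.exp ((θ τ : ℂ) * Complex.I) := by
    intro τ hτ
    have he : g =ᶠ[nhds τ] fun t => (ρ t : ℂ) * Complex.exp ((θ t : ℂ) * Complex.I) :=
      Filter.eventually_of_mem (hT.mem_nhds hτ) h
    have h2 : HasDerivAt (fun t => (ρ t : ℂ) * Complex.exp ((θ t : ℂ) * Complex.I)) _ τ :=
      (dρ τ hτ).ofReal_comp.mul (de τ hτ)
    rw [he.deriv_eq, h2.deriv]
    push_cast
    ring
  refine ⟨h1 t ht, ?_⟩
  have he : deriv g =ᶠ[nhds t] fun τ => (((deriv ρ τ : ℝ) : ℂ) + (ρ τ * deriv θ τ : ℝ) * Complex.I) *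
      Complex.exp ((θ τ : ℂ) * Complex.I) :=
    Filter.eventually_of_mem (hT.mem_nhds ht) h1
  have h2 : HasDerivAt (fun τ => (((deriv ρ τ : ℝ) : ℂ) + (ρ τ * deriv θ τ : ℝ) * Complex.I) *
      Complex.exp ((θ τ : ℂ) * Complex.I)) _ t :=
    (dρ'.ofReal_comp.add (((dρ t ht).mul dθ').ofReal_comp.mul_const Complex.I)).mul (de t ht)
  rw [he.deriv_eq, h2.deriv]
  simp only [Pi.add_apply, Pi.mul_apply]
  push_cast
  linear_combination ((ρ t : ℂ) * ((deriv θ t : ℝ) : ℂ) ^ 2 * Complex.exp ((θ t : ℂ) * Complex.I)) *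
    Complex.I_sq

lemma complex_mul_exp_eq_iff {x y x' y' θ : ℝ} :
    ((x : ℂ) + y * Complex.I) * Complex.exp ((θ : ℂ) * Complex.I) =
      ((x' : ℂ) + y' * Complex.I) * Complex.exp ((θ : ℂ) * Complex.I) ↔ x = x' ∧ y = y' := by
  rw [mul_left_inj' (Complex.exp_ne_zero _), Complex.ext_iff]
  simp

lemma norm_mul_exp (x y θ : ℝ) :
    ‖((x : ℂ) + y * Complex.I) * Complex.exp ((θ : ℂ) * Complex.I)‖ ^ 2 = x ^ 2 + y ^ 2 := by
  rw [norm_mul, Complex.norm_exp_ofReal_mul_I, mul_one, ← Complex.normSq_eq_norm_sq,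
    Complex.normSq_add_mul_I]

/-- The algebra behind the reduction of the spiral equation to polar coordinates. -/
lemma polar_algebra {a b p q r p' q' r' S : ℝ} (k₁ k₂ : ℝ) (ha : a ≠ 0) (hb : b ≠ 0)
    (hab : a ^ 2 + b ^ 2 = 1) (hS : S = p ^ 2 + a ^ 2 * q ^ 2 + b ^ 2 * r ^ 2) (hS0 : S ≠ 0) :
    (∃ l : ℝ,
      (S⁻¹ * ((-a * p ^ 2 - b * p') - a * q ^ 2) + ((k₁ + k₂ + 1) - k₁ / a ^ 2) * a =
          l * (-b * p) ∧
        S⁻¹ * (2 * (-b * p) * q + a * q') = l * (a * q)) ∧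
      (S⁻¹ * ((-b * p ^ 2 + a * p') - b * r ^ 2) + ((k₁ + k₂ + 1) - k₂ / b ^ 2) * b =
          l * (a * p) ∧
        S⁻¹ * (2 * (a * p) * r + b * r') = l * (b * r))) ↔
    ∃ μ : ℝ, μ * S = p * p' + a ^ 2 * q * q' + b ^ 2 * r * r' - a * b * p * q ^ 2 +
        a * b * p * r ^ 2 + S * (k₁ * (b / a) - k₂ * (a / b)) * p ∧
      2 * (-b * p) * q + a * q' = μ * (a * q) ∧
      2 * (a * p) * r + b * r' = μ * (b * r) ∧
      p' + a * b * (q ^ 2 - r ^ 2) + S * (k₁ * (b / a) - k₂ * (a / b)) = μ * p := by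
  -- With `k₁ = K₁ a` and `k₂ = K₂ b` the equations have no denominators other than `S`.
  obtain ⟨K₁, hK₁⟩ : ∃ K₁, K₁ * a = k₁ := ⟨k₁ / a, by field_simp⟩
  obtain ⟨K₂, hK₂⟩ : ∃ K₂, K₂ * b = k₂ := ⟨k₂ / b, by field_simp⟩
  have e1 : k₁ * (b / a) - k₂ * (a / b) = K₁ * b - K₂ * a := by
    rw [← hK₁, ← hK₂]; field_simp
  have e2 : ((k₁ + k₂ + 1) - k₁ / a ^ 2) * a = (k₁ + k₂ + 1) * a - K₁ := by
    rw [← hK₁]; field_simp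
  have e3 : ((k₁ + k₂ + 1) - k₂ / b ^ 2) * b = (k₁ + k₂ + 1) * b - K₂ := by
    rw [← hK₂]; field_simp
  rw [e1, e2, e3]
  have hi : S * S⁻¹ = 1 := mul_inv_cancel₀ hS0
  constructor
  · rintro ⟨l, ⟨h1, h2⟩, h3, h4⟩
    have h1' : ((-a * p ^ 2 - b * p') - a * q ^ 2) + S * ((k₁ + k₂ + 1) * a - K₁) =
        l * S * (-b * p) := by
      linear_combination S * h1 - ((-a * p ^ 2 - b * p') - a * q ^ 2) * hi
    have h3' : ((-b * p ^ 2 + a * p') - b * r ^ 2) + S * ((k₁ + k₂ + 1) * b - K₂) =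
        l * S * (a * p) := by
      linear_combination S * h3 - ((-b * p ^ 2 + a * p') - b * r ^ 2) * hi
    have h2' : 2 * (-b * p) * q + a * q' = l * S * (a * q) := by
      linear_combination S * h2 - (2 * (-b * p) * q + a * q') * hi
    have h4' : 2 * (a * p) * r + b * r' = l * S * (b * r) := by
      linear_combination S * h4 - (2 * (a * p) * r + b * r') * hi
    -- The two radial equations are projected onto `(-b, a)`, the direction of increasing `s`.
    have h5 : p' + a * b * (q ^ 2 - r ^ 2) + S * (K₁ * b - K₂ * a) = l * S * p := by
      linear_combination a * h3' - b * h1' + (l * S * p - p') * hab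
    refine ⟨l * S, ?_, h2', h4', h5⟩
    linear_combination (-p) * h5 - a * q * h2' - b * r * h4' + l * S * hS
  · rintro ⟨μ, -, h2, h4, h5⟩
    -- The projection onto the position direction `(a, b)` is an identity. Together with `h5` it
    -- recovers both radial equations.
    have hsum : a * (((-a * p ^ 2 - b * p') - a * q ^ 2) + S * ((k₁ + k₂ + 1) * a - K₁)) +
        b * (((-b * p ^ 2 + a * p') - b * r ^ 2) + S * ((k₁ + k₂ + 1) * b - K₂)) = 0 := by
      linear_combination (-p ^ 2 + S * (k₁ + k₂ + 1)) * hab - S * hK₁ - S * hK₂ + hS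
    have h1 : ((-a * p ^ 2 - b * p') - a * q ^ 2) + S * ((k₁ + k₂ + 1) * a - K₁) =
        μ * (-b * p) := by
      linear_combination a * hsum - b * h5 + (- (((-a * p ^ 2 - b * p') - a * q ^ 2) +
        S * ((k₁ + k₂ + 1) * a - K₁)) - b * p') * hab
    have h3 : ((-b * p ^ 2 + a * p') - b * r ^ 2) + S * ((k₁ + k₂ + 1) * b - K₂) =
        μ * (a * p) := by
      linear_combination b * hsum + a * h5 + (- (((-b * p ^ 2 + a * p') - b * r ^ 2) +
        S * ((k₁ + k₂ + 1) * b - K₂)) + a * p') * hab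
    refine ⟨S⁻¹ * μ, ⟨?_, ?_⟩, ?_, ?_⟩
    · linear_combination S⁻¹ * h1 - ((k₁ + k₂ + 1) * a - K₁) * hi
    · linear_combination S⁻¹ * h2
    · linear_combination S⁻¹ * h3 - ((k₁ + k₂ + 1) * b - K₂) * hi
    · linear_combination S⁻¹ * h4

end Polar

/-! ### The spiral equation in polar form. -/

section Polar

/-- The squared speed of the curve `(cos s e^{i s₁}, sin s e^{i s₂})`. -/
def polarSpeedSq (s s₁ s₂ : ℝ → ℝ) (t : ℝ) : ℝ :=
  deriv s t ^ 2 + Real.cos (s t) ^ 2 * deriv s₁ t ^ 2 + Real.sin (s t) ^ 2 * deriv s₂ t ^ 2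

/-- Half of the derivative of `polarSpeedSq`. -/
def polarSpeedSqDerivHalf (s s₁ s₂ : ℝ → ℝ) (t : ℝ) : ℝ :=
  deriv s t * deriv (deriv s) t + Real.cos (s t) ^ 2 * deriv s₁ t * deriv (deriv s₁) t +
    Real.sin (s t) ^ 2 * deriv s₂ t * deriv (deriv s₂) t -
    Real.cos (s t) * Real.sin (s t) * deriv s t * deriv s₁ t ^ 2 +
    Real.cos (s t) * Real.sin (s t) * deriv s t * deriv s₂ t ^ 2

/-- The logarithmic derivative of `cos^(-k₁) * sin^(-k₂)`. -/
def polarKappa (k₁ k₂ : ℕ) (s : ℝ → ℝ) (t : ℝ) : ℝ :=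
  k₁ * (Real.sin (s t) / Real.cos (s t)) - k₂ * (Real.cos (s t) / Real.sin (s t))

variable {T : Set ℝ} {s s₁ s₂ : ℝ → ℝ} {γ₁ γ₂ : ℝ → ℂ}

lemma ContDiffOn.hasDerivAt_of_isOpen (hT : IsOpen T) (hs : ContDiffOn ℝ 2 s T) {t : ℝ}
    (ht : t ∈ T) : HasDerivAt s (deriv s t) t :=
  ((hs.contDiffAt (hT.mem_nhds ht)).differentiableAt (by norm_num)).hasDerivAt

lemma ContDiffOn.hasDerivAt_deriv_of_isOpen (hT : IsOpen T) (hs : ContDiffOn ℝ 2 s T) {t : ℝ}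
    (ht : t ∈ T) : HasDerivAt (deriv s) (deriv (deriv s) t) t :=
  (((hs.deriv_of_isOpen hT (m := 1) (by norm_num)).contDiffAt (hT.mem_nhds ht)).differentiableAt
    (by norm_num)).hasDerivAt

lemma deriv_cos_comp (hT : IsOpen T) (hs : ContDiffOn ℝ 2 s T) {t : ℝ} (ht : t ∈ T) :
    deriv (fun t => Real.cos (s t)) t = -Real.sin (s t) * deriv s t :=
  (hs.hasDerivAt_of_isOpen hT ht).cos.deriv

lemma deriv_sin_comp (hT : IsOpen T) (hs : ContDiffOn ℝ 2 s T) {t : ℝ} (ht : t ∈ T) :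
    deriv (fun t => Real.sin (s t)) t = Real.cos (s t) * deriv s t :=
  (hs.hasDerivAt_of_isOpen hT ht).sin.deriv

lemma deriv_deriv_cos_comp (hT : IsOpen T) (hs : ContDiffOn ℝ 2 s T) {t : ℝ} (ht : t ∈ T) :
    deriv (deriv fun t => Real.cos (s t)) t =
      -Real.cos (s t) * deriv s t ^ 2 - Real.sin (s t) * deriv (deriv s) t := by
  have he : (deriv fun t => Real.cos (s t)) =ᶠ[nhds t] fun t => -Real.sin (s t) * deriv s t :=
    Filter.eventually_of_mem (hT.mem_nhds ht) fun τ hτ => deriv_cos_comp hT hs hτ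
  have h : HasDerivAt (fun t => -Real.sin (s t) * deriv s t) _ t :=
    (hs.hasDerivAt_of_isOpen hT ht).sin.neg.mul (hs.hasDerivAt_deriv_of_isOpen hT ht)
  rw [he.deriv_eq, h.deriv]
  simp only [Pi.neg_apply]
  ring

lemma deriv_deriv_sin_comp (hT : IsOpen T) (hs : ContDiffOn ℝ 2 s T) {t : ℝ} (ht : t ∈ T) :
    deriv (deriv fun t => Real.sin (s t)) t =
      -Real.sin (s t) * deriv s t ^ 2 + Real.cos (s t) * deriv (deriv s) t := by
  have he : (deriv fun t => Real.sin (s t)) =ᶠ[nhds t] fun t => Real.cos (s t) * deriv s t :=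
    Filter.eventually_of_mem (hT.mem_nhds ht) fun τ hτ => deriv_sin_comp hT hs hτ
  have h : HasDerivAt (fun t => Real.cos (s t) * deriv s t) _ t :=
    (hs.hasDerivAt_of_isOpen hT ht).cos.mul (hs.hasDerivAt_deriv_of_isOpen hT ht)
  rw [he.deriv_eq, h.deriv]
  ring

lemma IsPolarForm.cos_pos (hP : IsPolarForm T γ₁ γ₂ s s₁ s₂) {t : ℝ} (ht : t ∈ T) :
    0 < Real.cos (s t) :=
  Real.cos_pos_of_mem_Ioo ⟨by linarith [(hP.mem_Ioo t ht).1, Real.pi_pos], (hP.mem_Ioo t ht).2⟩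

lemma IsPolarForm.sin_pos (hP : IsPolarForm T γ₁ γ₂ s s₁ s₂) {t : ℝ} (ht : t ∈ T) :
    0 < Real.sin (s t) :=
  Real.sin_pos_of_pos_of_lt_pi (hP.mem_Ioo t ht).1
    (by linarith [(hP.mem_Ioo t ht).2, Real.pi_pos])

lemma IsPolarForm.contDiffOn_cos (hP : IsPolarForm T γ₁ γ₂ s s₁ s₂) :
    ContDiffOn ℝ 2 (fun t => Real.cos (s t)) T := Real.contDiff_cos.comp_contDiffOn hP.contDiff

lemma IsPolarForm.contDiffOn_sin (hP : IsPolarForm T γ₁ γ₂ s s₁ s₂) :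
    ContDiffOn ℝ 2 (fun t => Real.sin (s t)) T := Real.contDiff_sin.comp_contDiffOn hP.contDiff

lemma IsPolarForm.speedSq_eq (hP : IsPolarForm T γ₁ γ₂ s s₁ s₂) (hT : IsOpen T) {t : ℝ}
    (ht : t ∈ T) : ‖deriv γ₁ t‖ ^ 2 + ‖deriv γ₂ t‖ ^ 2 = polarSpeedSq s s₁ s₂ t := by
  rw [(deriv_polar hT hP.contDiffOn_cos hP.contDiff_fst hP.fst_eq ht).1,
    (deriv_polar hT hP.contDiffOn_sin hP.contDiff_snd hP.snd_eq ht).1, norm_mul_exp, norm_mul_exp,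
    deriv_cos_comp hT hP.contDiff ht, deriv_sin_comp hT hP.contDiff ht, polarSpeedSq]
  linear_combination deriv s t ^ 2 * Real.sin_sq_add_cos_sq (s t)

lemma IsPolarForm.curveSpeed_eq (hP : IsPolarForm T γ₁ γ₂ s s₁ s₂) (hT : IsOpen T) {t : ℝ}
    (ht : t ∈ T) : curveSpeed γ₁ γ₂ t = Real.sqrt (polarSpeedSq s s₁ s₂ t) := by
  rw [curveSpeed, hP.speedSq_eq hT ht]

lemma IsPolarForm.speedSq_pos (hP : IsPolarForm T γ₁ γ₂ s s₁ s₂) (hT : IsOpen T)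
    (hγ : IsImmersedCurveInSphere T γ₁ γ₂) {t : ℝ} (ht : t ∈ T) :
    0 < polarSpeedSq s s₁ s₂ t := by
  rw [← hP.speedSq_eq hT ht]
  rcases hγ.immersed t ht with h | h
  · have := norm_pos_iff.mpr h
    positivity
  · have := norm_pos_iff.mpr h
    positivity

lemma norm_ofReal_mul_exp {x : ℝ} (hx : 0 < x) (θ : ℝ) :
    ‖(x : ℂ) * Complex.exp ((θ : ℂ) * Complex.I)‖ = x := by
  rw [norm_mul, Complex.norm_exp_ofReal_mul_I, mul_one, Complex.norm_real, Real.norm_eq_abs,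
    abs_of_pos hx]

lemma polar_component_iff {S d l ρ ρ' ρ'' θ' θ'' θ : ℝ} :
    ((S : ℂ) * (((ρ'' - ρ * θ' ^ 2 : ℝ) + (2 * ρ' * θ' + ρ * θ'' : ℝ) * Complex.I) *
        Complex.exp ((θ : ℂ) * Complex.I)) +
      (d : ℂ) * ((ρ : ℂ) * Complex.exp ((θ : ℂ) * Complex.I)) =
      (l : ℂ) * (((ρ' : ℂ) + (ρ * θ' : ℝ) * Complex.I) * Complex.exp ((θ : ℂ) * Complex.I))) ↔
    S * (ρ'' - ρ * θ' ^ 2) + d * ρ = l * ρ' ∧ S * (2 * ρ' * θ' + ρ * θ'') = l * (ρ * θ') := by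
  rw [← complex_mul_exp_eq_iff (θ := θ)]
  push_cast
  constructor <;> intro h <;> linear_combination h

/-- The spiral equation in polar coordinates. -/
lemma IsPolarForm.spiralEquation_iff (hP : IsPolarForm T γ₁ γ₂ s s₁ s₂) (hT : IsOpen T)
    (hγ : IsImmersedCurveInSphere T γ₁ γ₂) (k₁ k₂ : ℕ) {t : ℝ} (ht : t ∈ T) :
    SpiralEquation k₁ k₂ γ₁ γ₂ t ↔
    ∃ μ : ℝ, μ * polarSpeedSq s s₁ s₂ t = polarSpeedSqDerivHalf s s₁ s₂ t +
        polarSpeedSq s s₁ s₂ t * polarKappa k₁ k₂ s t * deriv s t ∧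
      2 * (-Real.sin (s t) * deriv s t) * deriv s₁ t + Real.cos (s t) * deriv (deriv s₁) t =
        μ * (Real.cos (s t) * deriv s₁ t) ∧
      2 * (Real.cos (s t) * deriv s t) * deriv s₂ t + Real.sin (s t) * deriv (deriv s₂) t =
        μ * (Real.sin (s t) * deriv s₂ t) ∧
      deriv (deriv s) t + Real.cos (s t) * Real.sin (s t) * (deriv s₁ t ^ 2 - deriv s₂ t ^ 2) +
        polarSpeedSq s s₁ s₂ t * polarKappa k₁ k₂ s t = μ * deriv s t := by
  rw [SpiralEquation, hP.speedSq_eq hT ht,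
    (deriv_polar hT hP.contDiffOn_cos hP.contDiff_fst hP.fst_eq ht).1,
    (deriv_polar hT hP.contDiffOn_sin hP.contDiff_snd hP.snd_eq ht).1,
    (deriv_polar hT hP.contDiffOn_cos hP.contDiff_fst hP.fst_eq ht).2,
    (deriv_polar hT hP.contDiffOn_sin hP.contDiff_snd hP.snd_eq ht).2,
    hP.fst_eq t ht, hP.snd_eq t ht, norm_ofReal_mul_exp (hP.cos_pos ht),
    norm_ofReal_mul_exp (hP.sin_pos ht)]
  simp only [polar_component_iff]
  rw [deriv_cos_comp hT hP.contDiff ht, deriv_sin_comp hT hP.contDiff ht,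
    deriv_deriv_cos_comp hT hP.contDiff ht, deriv_deriv_sin_comp hT hP.contDiff ht]
  exact polar_algebra (S := polarSpeedSq s s₁ s₂ t) k₁ k₂ (hP.cos_pos ht).ne' (hP.sin_pos ht).ne'
    (Real.cos_sq_add_sin_sq _) rfl (hP.speedSq_pos hT hγ ht).ne'

end Polar

/-! ### The two conserved momenta. -/

section Momentum

variable {T : Set ℝ} {s s₁ s₂ : ℝ → ℝ} {γ₁ γ₂ : ℝ → ℂ}

/-- The logarithmic form of the power rule avoids the exponent `n - 1`, so that `n = 0` is no
exception. -/
lemma HasDerivAt.pow_div {f : ℝ → ℝ} {f' t : ℝ} (hf : HasDerivAt f f' t) (h0 : f t ≠ 0) (n : ℕ) :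
    HasDerivAt (fun t => f t ^ n) (f t ^ n * (n * (f' / f t))) t := by
  refine (hf.fun_pow n).congr_deriv ?_
  cases n with
  | zero => simp
  | succ n => simp only [Nat.add_sub_cancel]; field_simp; ring

lemma IsPolarForm.hasDerivAt_speedSq (hP : IsPolarForm T γ₁ γ₂ s s₁ s₂) (hT : IsOpen T) {t : ℝ}
    (ht : t ∈ T) :
    HasDerivAt (polarSpeedSq s s₁ s₂) (2 * polarSpeedSqDerivHalf s s₁ s₂ t) t := by
  have h := hP.contDiff.hasDerivAt_of_isOpen hT ht
  have h' := hP.contDiff.hasDerivAt_deriv_of_isOpen hT ht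
  have h1 := hP.contDiff_fst.hasDerivAt_deriv_of_isOpen hT ht
  have h2 := hP.contDiff_snd.hasDerivAt_deriv_of_isOpen hT ht
  have H : HasDerivAt (polarSpeedSq s s₁ s₂) _ t :=
    ((h'.fun_pow 2).add ((h.cos.fun_pow 2).mul (h1.fun_pow 2))).add
      ((h.sin.fun_pow 2).mul (h2.fun_pow 2))
  refine H.congr_deriv ?_
  rw [polarSpeedSqDerivHalf]
  ring

/-- The derivative of the conserved quantities of a solution curve. -/
lemma IsPolarForm.hasDerivAt_momentum (hP : IsPolarForm T γ₁ γ₂ s s₁ s₂) (hT : IsOpen T)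
    (hγ : IsImmersedCurveInSphere T γ₁ γ₂) {q : ℝ → ℝ} {q' : ℝ} {t : ℝ} (ht : t ∈ T)
    (hq : HasDerivAt q q' t) (m n : ℕ) :
    HasDerivAt (fun t => q t * Real.cos (s t) ^ m * Real.sin (s t) ^ n /
        Real.sqrt (polarSpeedSq s s₁ s₂ t))
      (Real.cos (s t) ^ m * Real.sin (s t) ^ n / Real.sqrt (polarSpeedSq s s₁ s₂ t) *
        (q' - q t * (polarKappa m n s t * deriv s t +
          polarSpeedSqDerivHalf s s₁ s₂ t / polarSpeedSq s s₁ s₂ t))) t := by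
  have h := hP.contDiff.hasDerivAt_of_isOpen hT ht
  have hS := hP.speedSq_pos hT hγ ht
  have hr := Real.sqrt_pos.mpr hS
  have hc := hP.cos_pos ht
  have hs := hP.sin_pos ht
  have H := ((hq.mul (h.cos.pow_div hc.ne' m)).mul (h.sin.pow_div hs.ne' n)).fun_div
    ((hP.hasDerivAt_speedSq hT ht).sqrt hS.ne') hr.ne'
  refine H.congr_deriv ?_
  rw [polarKappa]
  simp only [Pi.mul_apply]
  have hsq := Real.sq_sqrt hS.le
  set σ := Real.sqrt (polarSpeedSq s s₁ s₂ t)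
  rw [← hsq]
  field_simp
  ring

/-- The derivative is a nonvanishing multiple of the defect in the first angular equation. Thus that
equation and the conservation law are equivalent, and both directions are used. -/
lemma IsPolarForm.hasDerivAt_momentum_fst (hP : IsPolarForm T γ₁ γ₂ s s₁ s₂) (hT : IsOpen T)
    (hγ : IsImmersedCurveInSphere T γ₁ γ₂) (k₁ k₂ : ℕ) {t : ℝ} (ht : t ∈ T) {μ : ℝ}
    (hμ : μ * polarSpeedSq s s₁ s₂ t = polarSpeedSqDerivHalf s s₁ s₂ t +
        polarSpeedSq s s₁ s₂ t * polarKappa k₁ k₂ s t * deriv s t) :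
    HasDerivAt (fun t => deriv s₁ t * Real.cos (s t) ^ (k₁ + 2) * Real.sin (s t) ^ k₂ /
        Real.sqrt (polarSpeedSq s s₁ s₂ t))
      (Real.cos (s t) ^ (k₁ + 1) * Real.sin (s t) ^ k₂ / Real.sqrt (polarSpeedSq s s₁ s₂ t) *
        (2 * (-Real.sin (s t) * deriv s t) * deriv s₁ t + Real.cos (s t) * deriv (deriv s₁) t -
        μ * (Real.cos (s t) * deriv s₁ t))) t := by
  refine (hP.hasDerivAt_momentum hT hγ ht (hP.contDiff_fst.hasDerivAt_deriv_of_isOpen hT ht)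
    (k₁ + 2) k₂).congr_deriv ?_
  have hS := hP.speedSq_pos hT hγ ht
  have hr := Real.sqrt_pos.mpr hS
  have hc := hP.cos_pos ht
  have hs := hP.sin_pos ht
  have hμ' : μ = polarSpeedSqDerivHalf s s₁ s₂ t / polarSpeedSq s s₁ s₂ t +
      polarKappa k₁ k₂ s t * deriv s t := by
    field_simp
    linear_combination hμ
  rw [hμ']
  simp only [polarKappa]
  push_cast
  field_simp
  ring

lemma IsPolarForm.hasDerivAt_momentum_snd (hP : IsPolarForm T γ₁ γ₂ s s₁ s₂) (hT : IsOpen T)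
    (hγ : IsImmersedCurveInSphere T γ₁ γ₂) (k₁ k₂ : ℕ) {t : ℝ} (ht : t ∈ T) {μ : ℝ}
    (hμ : μ * polarSpeedSq s s₁ s₂ t = polarSpeedSqDerivHalf s s₁ s₂ t +
        polarSpeedSq s s₁ s₂ t * polarKappa k₁ k₂ s t * deriv s t) :
    HasDerivAt (fun t => deriv s₂ t * Real.cos (s t) ^ k₁ * Real.sin (s t) ^ (k₂ + 2) /
        Real.sqrt (polarSpeedSq s s₁ s₂ t))
      (Real.cos (s t) ^ k₁ * Real.sin (s t) ^ (k₂ + 1) / Real.sqrt (polarSpeedSq s s₁ s₂ t) *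
        (2 * (Real.cos (s t) * deriv s t) * deriv s₂ t + Real.sin (s t) * deriv (deriv s₂) t -
        μ * (Real.sin (s t) * deriv s₂ t))) t := by
  refine (hP.hasDerivAt_momentum hT hγ ht (hP.contDiff_snd.hasDerivAt_deriv_of_isOpen hT ht)
    k₁ (k₂ + 2)).congr_deriv ?_
  have hS := hP.speedSq_pos hT hγ ht
  have hr := Real.sqrt_pos.mpr hS
  have hc := hP.cos_pos ht
  have hs := hP.sin_pos ht
  have hμ' : μ = polarSpeedSqDerivHalf s s₁ s₂ t / polarSpeedSq s s₁ s₂ t +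
      polarKappa k₁ k₂ s t * deriv s t := by
    field_simp
    linear_combination hμ
  rw [hμ']
  simp only [polarKappa]
  push_cast
  field_simp
  ring

/-- A curve satisfying the spiral equation is a solution curve. -/
lemma IsPolarForm.exists_isSolutionCurve (hP : IsPolarForm T γ₁ γ₂ s s₁ s₂) (hT : IsOpen T)
    (hTc : T.OrdConnected) (hγ : IsImmersedCurveInSphere T γ₁ γ₂) (k₁ k₂ : ℕ)
    (h : ∀ t ∈ T, SpiralEquation k₁ k₂ γ₁ γ₂ t) :
    ∃ c₁ c₂, IsSolutionCurve k₁ k₂ c₁ c₂ T γ₁ γ₂ s s₁ s₂ := by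
  have hd₁ : ∀ t ∈ T, HasDerivAt (fun t => deriv s₁ t * Real.cos (s t) ^ (k₁ + 2) *
      Real.sin (s t) ^ k₂ / Real.sqrt (polarSpeedSq s s₁ s₂ t)) 0 t := fun t ht => by
    obtain ⟨μ, h0, h1, -, -⟩ := (hP.spiralEquation_iff hT hγ k₁ k₂ ht).mp (h t ht)
    refine (hP.hasDerivAt_momentum_fst hT hγ k₁ k₂ ht h0).congr_deriv ?_
    rw [h1, sub_self, mul_zero]
  have hd₂ : ∀ t ∈ T, HasDerivAt (fun t => deriv s₂ t * Real.cos (s t) ^ k₁ *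
      Real.sin (s t) ^ (k₂ + 2) / Real.sqrt (polarSpeedSq s s₁ s₂ t)) 0 t := fun t ht => by
    obtain ⟨μ, h0, -, h2, -⟩ := (hP.spiralEquation_iff hT hγ k₁ k₂ ht).mp (h t ht)
    refine (hP.hasDerivAt_momentum_snd hT hγ k₁ k₂ ht h0).congr_deriv ?_
    rw [h2, sub_self, mul_zero]
  obtain ⟨c₁, hc₁⟩ := hT.exists_is_const_of_deriv_eq_zero hTc.isPreconnected
    (fun t ht => (hd₁ t ht).differentiableAt.differentiableWithinAt)
    (fun t ht => (hd₁ t ht).deriv)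
  obtain ⟨c₂, hc₂⟩ := hT.exists_is_const_of_deriv_eq_zero hTc.isPreconnected
    (fun t ht => (hd₂ t ht).differentiableAt.differentiableWithinAt)
    (fun t ht => (hd₂ t ht).deriv)
  refine ⟨c₁, c₂, hP, fun t ht => ?_, fun t ht => ?_⟩
  · rw [hP.curveSpeed_eq hT ht, ← hc₁ t ht]
    have hr := Real.sqrt_pos.mpr (hP.speedSq_pos hT hγ ht)
    have hc := hP.cos_pos ht
    have hs := hP.sin_pos ht
    field_simp
  · rw [hP.curveSpeed_eq hT ht, ← hc₂ t ht]
    have hr := Real.sqrt_pos.mpr (hP.speedSq_pos hT hγ ht)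
    have hc := hP.cos_pos ht
    have hs := hP.sin_pos ht
    field_simp

end Momentum

/-! ### Uniqueness at a double root, and the energy polynomial. -/

section Rigidity

/-- Forward uniqueness for `z' ^ 2 = (z - z₀) ^ 2 * K`. -/
lemma eq_of_deriv_sq_eq_of_le {z z' K : ℝ → ℝ} {z₀ x y : ℝ} (hxy : x ≤ y)
    (hz : ∀ t ∈ Set.Icc x y, HasDerivAt z (z' t) t) (hK : ContinuousOn K (Set.Icc x y))
    (h : ∀ t ∈ Set.Icc x y, z' t ^ 2 = (z t - z₀) ^ 2 * K t) (hx : z x = z₀) : z y = z₀ := by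
  obtain ⟨M, hM⟩ := isCompact_Icc.bddAbove_image hK
  have hM' : ∀ t ∈ Set.Icc x y, K t ≤ M := fun t ht => hM ⟨t, ht, rfl⟩
  -- Grönwall's argument: for `w = z - z₀`, `2 w w' ≤ w² + w'² ≤ (1 + M) w²`, which dictates the
  -- exponent `-(1 + M)`.
  have hd : ∀ t ∈ Set.Icc x y, HasDerivAt (fun t => (z t - z₀) ^ 2 * Real.exp (-(1 + M) * t))
      ((2 * (z t - z₀) * z' t - (1 + M) * (z t - z₀) ^ 2) * Real.exp (-(1 + M) * t)) t := by
    intro t ht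
    have h1 := (((hz t ht).sub_const z₀).fun_pow 2).mul
      (((hasDerivAt_id t).const_mul (-(1 + M))).exp)
    refine h1.congr_deriv ?_
    simp only [id]
    ring
  have hanti : AntitoneOn (fun t => (z t - z₀) ^ 2 * Real.exp (-(1 + M) * t)) (Set.Icc x y) := by
    refine antitoneOn_of_deriv_nonpos (convex_Icc x y)
      (fun t ht => (hd t ht).continuousAt.continuousWithinAt)
      (fun t ht => (hd t (interior_subset ht)).differentiableAt.differentiableWithinAt) ?_
    intro t ht
    have ht' := interior_subset ht
    rw [(hd t ht').deriv]
    refine mul_nonpos_of_nonpos_of_nonneg ?_ (Real.exp_pos _).le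
    nlinarith [sq_nonneg (z t - z₀ - z' t), h t ht',
      mul_le_mul_of_nonneg_left (hM' t ht') (sq_nonneg (z t - z₀))]
  have h2 := hanti ⟨le_rfl, hxy⟩ ⟨hxy, le_rfl⟩ hxy
  simp only [hx, sub_self, zero_pow two_ne_zero, zero_mul] at h2
  have h3 : (z y - z₀) ^ 2 = 0 :=
    le_antisymm (nonpos_of_mul_nonpos_left h2 (Real.exp_pos _)) (sq_nonneg _)
  exact sub_eq_zero.mp (pow_eq_zero_iff two_ne_zero |>.mp h3)

/-- Uniqueness for `z' ^ 2 = (z - z₀) ^ 2 * K` on an interval. -/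
lemma eq_of_deriv_sq_eq {T : Set ℝ} (hT : T.OrdConnected) {z z' K : ℝ → ℝ} {z₀ t₀ : ℝ}
    (hz : ∀ t ∈ T, HasDerivAt z (z' t) t) (hK : ContinuousOn K T)
    (h : ∀ t ∈ T, z' t ^ 2 = (z t - z₀) ^ 2 * K t) (ht₀ : t₀ ∈ T) (h0 : z t₀ = z₀) :
    ∀ t ∈ T, z t = z₀ := by
  intro t ht
  rcases le_total t₀ t with hle | hle
  · have hsub := hT.out ht₀ ht
    exact eq_of_deriv_sq_eq_of_le hle (fun τ hτ => hz τ (hsub hτ)) (hK.mono hsub)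
      (fun τ hτ => h τ (hsub hτ)) h0
  -- Backward uniqueness follows by time reversal, since the equation only involves `z'²`.
  · have hsub : ∀ τ ∈ Set.Icc (-t₀) (-t), -τ ∈ T := fun τ hτ =>
      hT.out ht ht₀ ⟨by linarith [hτ.2], by linarith [hτ.1]⟩
    have := eq_of_deriv_sq_eq_of_le (z := fun τ => z (-τ)) (z' := fun τ => -z' (-τ))
      (K := fun τ => K (-τ)) (z₀ := z₀) (neg_le_neg hle)
      (fun τ hτ => by
        have h1 := (hz (-τ) (hsub τ hτ)).scomp τ (hasDerivAt_neg τ)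
        refine h1.congr_deriv ?_
        simp)
      (hK.comp continuous_neg.continuousOn hsub)
      (fun τ hτ => by rw [neg_sq]; exact h _ (hsub τ hτ)) (by simpa using h0)
    simpa using this

/-- The polynomial governing the magnitude `z = cos² s` of a solution curve. -/
def energyPoly (k₁ k₂ : ℕ) (c₁ c₂ : ℝ) : Polynomial ℝ :=
  Polynomial.X ^ (k₁ + 1) * (1 - Polynomial.X) ^ (k₂ + 1) -
    Polynomial.C (c₁ ^ 2) * (1 - Polynomial.X) - Polynomial.C (c₂ ^ 2) * Polynomial.X

lemma energyPoly_eval (k₁ k₂ : ℕ) (c₁ c₂ z : ℝ) : (energyPoly k₁ k₂ c₁ c₂).eval z =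
    z ^ (k₁ + 1) * (1 - z) ^ (k₂ + 1) - c₁ ^ 2 * (1 - z) - c₂ ^ 2 * z := by
  simp [energyPoly]

lemma energyPoly_derivative_eval (k₁ k₂ : ℕ) (c₁ c₂ z : ℝ) :
    (energyPoly k₁ k₂ c₁ c₂).derivative.eval z =
    z ^ k₁ * (1 - z) ^ k₂ * ((k₁ + 1) * (1 - z) - (k₂ + 1) * z) + c₁ ^ 2 - c₂ ^ 2 := by
  simp [energyPoly, Polynomial.derivative_pow]
  ring

/-- The factor theorem, applied to `P` and then to its quotient. -/
lemma Polynomial.exists_eq_sq_mul_of_isRoot {P : Polynomial ℝ} {z : ℝ} (h0 : P.eval z = 0)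
    (h1 : P.derivative.eval z = 0) :
    ∃ Q : Polynomial ℝ, P = (Polynomial.X - Polynomial.C z) ^ 2 * Q := by
  obtain ⟨Q, hQ⟩ := Polynomial.dvd_iff_isRoot.mpr h0
  rw [hQ] at h1
  have h2 : Q.eval z = 0 := by simpa using h1
  obtain ⟨Q', hQ'⟩ := Polynomial.dvd_iff_isRoot.mpr h2
  exact ⟨Q', by rw [hQ, hQ']; ring⟩

end Rigidity

/-! ### Solution curves and the radial equation. -/

section SolutionCurve

variable {T : Set ℝ} {s s₁ s₂ : ℝ → ℝ} {γ₁ γ₂ : ℝ → ℂ} {k₁ k₂ : ℕ} {c₁ c₂ : ℝ}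

/-- The part of the acceleration of `s` that does not involve the derivative of `s`. -/
def polarForce (k₁ k₂ : ℕ) (s s₁ s₂ : ℝ → ℝ) (t : ℝ) : ℝ :=
  Real.cos (s t) * Real.sin (s t) * (deriv s₁ t ^ 2 - deriv s₂ t ^ 2) +
    polarSpeedSq s s₁ s₂ t * polarKappa k₁ k₂ s t

/-- The factor of proportionality in the spiral equation in polar coordinates. -/
def polarFactor (k₁ k₂ : ℕ) (s s₁ s₂ : ℝ → ℝ) (t : ℝ) : ℝ :=
  polarSpeedSqDerivHalf s s₁ s₂ t / polarSpeedSq s s₁ s₂ t + polarKappa k₁ k₂ s t * deriv s t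

/-- The defect in the equation for the magnitudes. -/
def polarResidual (k₁ k₂ : ℕ) (s s₁ s₂ : ℝ → ℝ) (t : ℝ) : ℝ :=
  deriv (deriv s) t + polarForce k₁ k₂ s s₁ s₂ t - polarFactor k₁ k₂ s s₁ s₂ t * deriv s t

lemma IsSolutionCurve.mul_fst (h : IsSolutionCurve k₁ k₂ c₁ c₂ T γ₁ γ₂ s s₁ s₂) (hT : IsOpen T)
    {t : ℝ} (ht : t ∈ T) :
    deriv s₁ t * Real.cos (s t) ^ (k₁ + 2) * Real.sin (s t) ^ k₂ =
      c₁ * Real.sqrt (polarSpeedSq s s₁ s₂ t) := by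
  have hc := h.polar.cos_pos ht
  have hs := h.polar.sin_pos ht
  rw [h.fst_eq t ht, h.polar.curveSpeed_eq hT ht]
  field_simp

lemma IsSolutionCurve.mul_snd (h : IsSolutionCurve k₁ k₂ c₁ c₂ T γ₁ γ₂ s s₁ s₂) (hT : IsOpen T)
    {t : ℝ} (ht : t ∈ T) :
    deriv s₂ t * Real.cos (s t) ^ k₁ * Real.sin (s t) ^ (k₂ + 2) =
      c₂ * Real.sqrt (polarSpeedSq s s₁ s₂ t) := by
  have hc := h.polar.cos_pos ht
  have hs := h.polar.sin_pos ht
  rw [h.snd_eq t ht, h.polar.curveSpeed_eq hT ht]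
  field_simp

lemma IsPolarForm.polarFactor_mul (hP : IsPolarForm T γ₁ γ₂ s s₁ s₂) (hT : IsOpen T)
    (hγ : IsImmersedCurveInSphere T γ₁ γ₂) {t : ℝ} (ht : t ∈ T) :
    polarFactor k₁ k₂ s s₁ s₂ t * polarSpeedSq s s₁ s₂ t = polarSpeedSqDerivHalf s s₁ s₂ t +
        polarSpeedSq s s₁ s₂ t * polarKappa k₁ k₂ s t * deriv s t := by
  have hS := hP.speedSq_pos hT hγ ht
  rw [polarFactor]
  field_simp

/-- The momentum is constantly `c₁`, and its derivative is a positive factor times the defect of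
this equation. -/
lemma IsSolutionCurve.fst_eq' (h : IsSolutionCurve k₁ k₂ c₁ c₂ T γ₁ γ₂ s s₁ s₂) (hT : IsOpen T)
    (hγ : IsImmersedCurveInSphere T γ₁ γ₂) {t : ℝ} (ht : t ∈ T) :
    2 * (-Real.sin (s t) * deriv s t) * deriv s₁ t + Real.cos (s t) * deriv (deriv s₁) t =
        polarFactor k₁ k₂ s s₁ s₂ t * (Real.cos (s t) * deriv s₁ t) := by
  have hd := h.polar.hasDerivAt_momentum_fst hT hγ k₁ k₂ ht (h.polar.polarFactor_mul hT hγ ht)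
  have he : (fun t => deriv s₁ t * Real.cos (s t) ^ (k₁ + 2) * Real.sin (s t) ^ k₂ /
        Real.sqrt (polarSpeedSq s s₁ s₂ t)) =ᶠ[nhds t] fun _ => c₁ :=
    Filter.eventually_of_mem (hT.mem_nhds ht) fun τ hτ => by
      have hr := Real.sqrt_pos.mpr (h.polar.speedSq_pos hT hγ hτ)
      simp only [h.mul_fst hT hτ]
      field_simp
  have h0 := hd.deriv
  rw [he.deriv_eq, deriv_const] at h0
  have hr := Real.sqrt_pos.mpr (h.polar.speedSq_pos hT hγ ht)
  have hc := h.polar.cos_pos ht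
  have hs := h.polar.sin_pos ht
  exact sub_eq_zero.mp ((mul_eq_zero.mp h0.symm).resolve_left (by positivity))

lemma IsSolutionCurve.snd_eq' (h : IsSolutionCurve k₁ k₂ c₁ c₂ T γ₁ γ₂ s s₁ s₂) (hT : IsOpen T)
    (hγ : IsImmersedCurveInSphere T γ₁ γ₂) {t : ℝ} (ht : t ∈ T) :
    2 * (Real.cos (s t) * deriv s t) * deriv s₂ t + Real.sin (s t) * deriv (deriv s₂) t =
        polarFactor k₁ k₂ s s₁ s₂ t * (Real.sin (s t) * deriv s₂ t) := by
  have hd := h.polar.hasDerivAt_momentum_snd hT hγ k₁ k₂ ht (h.polar.polarFactor_mul hT hγ ht)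
  have he : (fun t => deriv s₂ t * Real.cos (s t) ^ k₁ * Real.sin (s t) ^ (k₂ + 2) /
        Real.sqrt (polarSpeedSq s s₁ s₂ t)) =ᶠ[nhds t] fun _ => c₂ :=
    Filter.eventually_of_mem (hT.mem_nhds ht) fun τ hτ => by
      have hr := Real.sqrt_pos.mpr (h.polar.speedSq_pos hT hγ hτ)
      simp only [h.mul_snd hT hτ]
      field_simp
  have h0 := hd.deriv
  rw [he.deriv_eq, deriv_const] at h0
  have hr := Real.sqrt_pos.mpr (h.polar.speedSq_pos hT hγ ht)
  have hc := h.polar.cos_pos ht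
  have hs := h.polar.sin_pos ht
  exact sub_eq_zero.mp ((mul_eq_zero.mp h0.symm).resolve_left (by positivity))

/-- For a solution curve, the spiral equation reduces to the equation for the magnitudes. -/
lemma IsSolutionCurve.spiralEquation_iff (h : IsSolutionCurve k₁ k₂ c₁ c₂ T γ₁ γ₂ s s₁ s₂)
    (hT : IsOpen T) (hγ : IsImmersedCurveInSphere T γ₁ γ₂) {t : ℝ} (ht : t ∈ T) :
    SpiralEquation k₁ k₂ γ₁ γ₂ t ↔ polarResidual k₁ k₂ s s₁ s₂ t = 0 := by
  rw [h.polar.spiralEquation_iff hT hγ k₁ k₂ ht, polarResidual, polarForce]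
  have hS := h.polar.speedSq_pos hT hγ ht
  have hμ := h.polar.polarFactor_mul (k₁ := k₁) (k₂ := k₂) hT hγ ht
  constructor
  · rintro ⟨μ, h0, -, -, h3⟩
    have : μ = polarFactor k₁ k₂ s s₁ s₂ t := mul_right_cancel₀ hS.ne' (h0.trans hμ.symm)
    rw [← this]
    linear_combination h3
  · intro h3
    exact ⟨_, hμ, h.fst_eq' hT hγ ht, h.snd_eq' hT hγ ht, by linear_combination h3⟩

/-- The definition of `polarFactor` amounts to pairing the full equation with the velocity. Removing
the two angular equations from this identity leaves `s'` times the radial one, which is therefore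
automatic wherever `s' ≠ 0`. -/
lemma IsSolutionCurve.deriv_mul_residual (h : IsSolutionCurve k₁ k₂ c₁ c₂ T γ₁ γ₂ s s₁ s₂)
    (hT : IsOpen T) (hγ : IsImmersedCurveInSphere T γ₁ γ₂) {t : ℝ} (ht : t ∈ T) :
    deriv s t * polarResidual k₁ k₂ s s₁ s₂ t = 0 := by
  have hμ := h.polar.polarFactor_mul (k₁ := k₁) (k₂ := k₂) hT hγ ht
  have h1 := h.fst_eq' hT hγ ht
  have h2 := h.snd_eq' hT hγ ht
  rw [polarSpeedSqDerivHalf] at hμ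
  rw [polarResidual, polarForce]
  have hS : polarSpeedSq s s₁ s₂ t = deriv s t ^ 2 + Real.cos (s t) ^ 2 * deriv s₁ t ^ 2 +
    Real.sin (s t) ^ 2 * deriv s₂ t ^ 2 := rfl
  linear_combination (-Real.cos (s t) * deriv s₁ t) * h1 - (Real.sin (s t) * deriv s₂ t) * h2 -
    hμ + polarFactor k₁ k₂ s s₁ s₂ t * hS

/-- In the application `σ` is the speed, not an angle, and `Z = a^k₁ b^k₂`. Once `c₁` and `c₂` are
eliminated, the defects of the two equations agree up to a nonzero factor, displayed in `key`. -/
lemma steady_algebra {a b q r S Z c₁ c₂ σ : ℝ} (k₁ k₂ : ℝ) (ha : a ≠ 0) (hb : b ≠ 0) (hZ : Z ≠ 0)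
    (hσ : σ ≠ 0) (hab : a ^ 2 + b ^ 2 = 1) (hq : q * a ^ 2 * Z = c₁ * σ)
    (hr : r * b ^ 2 * Z = c₂ * σ) (hS : S = a ^ 2 * q ^ 2 + b ^ 2 * r ^ 2) :
    a * b * (q ^ 2 - r ^ 2) + S * (k₁ * (b / a) - k₂ * (a / b)) = 0 ↔
      (c₂ ^ 2 - c₁ ^ 2) * a ^ 2 * (2 * k₁ * (b / a) - (2 * k₂ + 2) * (a / b)) =
        c₁ ^ 2 * (-(2 * k₁ + 2) * (b / a) + (2 * k₂ + 2) * (a / b)) := by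
  have hc₁ : c₁ = q * a ^ 2 * Z / σ := by field_simp; linear_combination -hq
  have hc₂ : c₂ = r * b ^ 2 * Z / σ := by field_simp; linear_combination -hr
  have key : σ ^ 2 * ((c₂ ^ 2 - c₁ ^ 2) * a ^ 2 * (2 * k₁ * (b / a) - (2 * k₂ + 2) * (a / b)) -
        c₁ ^ 2 * (-(2 * k₁ + 2) * (b / a) + (2 * k₂ + 2) * (a / b))) =
      2 * a ^ 2 * b ^ 2 * Z ^ 2 *
        (a * b * (q ^ 2 - r ^ 2) + S * (k₁ * (b / a) - k₂ * (a / b))) := by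
    rw [hc₁, hc₂, hS]
    field_simp
    linear_combination (q ^ 2 * a ^ 2 * ((k₂ + 1) * a ^ 2 - (k₁ + 1) * b ^ 2)) * hab
  rw [← sub_eq_zero (a := (c₂ ^ 2 - c₁ ^ 2) * a ^ 2 * _)]
  constructor
  · intro h
    rw [h, mul_zero] at key
    exact (mul_eq_zero.mp key).resolve_left (pow_ne_zero 2 hσ)
  · intro h
    rw [h, mul_zero] at key
    exact (mul_eq_zero.mp key.symm).resolve_left (by positivity)

/-- For constant magnitudes, the spiral equation is the steady equation. -/
lemma IsSolutionCurve.polarResidual_eq_zero_iff_of_const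
    (h : IsSolutionCurve k₁ k₂ c₁ c₂ T γ₁ γ₂ s s₁ s₂)
    (hT : IsOpen T) (hγ : IsImmersedCurveInSphere T γ₁ γ₂) {σ : ℝ} (hσ : ∀ t ∈ T, s t = σ)
    {t : ℝ} (ht : t ∈ T) :
    polarResidual k₁ k₂ s s₁ s₂ t = 0 ↔
    (c₂ ^ 2 - c₁ ^ 2) * Real.cos σ ^ 2 *
        (2 * k₁ * Real.tan σ - (2 * k₂ + 2) * Real.cot σ) =
      c₁ ^ 2 * (-(2 * k₁ + 2) * Real.tan σ + (2 * k₂ + 2) * Real.cot σ) := by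
  have hp : ∀ τ ∈ T, deriv s τ = 0 := fun τ hτ => by
    have he : s =ᶠ[nhds τ] fun _ => σ := Filter.eventually_of_mem (hT.mem_nhds hτ) hσ
    rw [he.deriv_eq, deriv_const]
  have hp' : deriv (deriv s) t = 0 := by
    have he : deriv s =ᶠ[nhds t] fun _ => 0 := Filter.eventually_of_mem (hT.mem_nhds ht) hp
    rw [he.deriv_eq, deriv_const]
  have hc := h.polar.cos_pos ht
  have hs := h.polar.sin_pos ht
  rw [← hσ t ht, polarResidual, hp', hp t ht, polarForce, polarKappa, Real.tan_eq_sin_div_cos,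
    Real.cot_eq_cos_div_sin, zero_add, mul_zero, sub_zero]
  refine steady_algebra (Z := Real.cos (s t) ^ k₁ * Real.sin (s t) ^ k₂)
    (σ := Real.sqrt (polarSpeedSq s s₁ s₂ t)) k₁ k₂ hc.ne' hs.ne' (by positivity)
    (Real.sqrt_pos.mpr (h.polar.speedSq_pos hT hγ ht)).ne' (Real.cos_sq_add_sin_sq _) ?_ ?_ ?_
  · rw [← h.mul_fst hT ht]; ring
  · rw [← h.mul_snd hT ht]; ring
  · rw [polarSpeedSq, hp t ht]; ring

end SolutionCurve

/-! ### Energy, and solution curves of varying magnitudes. -/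

section Varying

variable {T : Set ℝ} {s s₁ s₂ : ℝ → ℝ} {γ₁ γ₂ : ℝ → ℂ} {k₁ k₂ : ℕ} {c₁ c₂ : ℝ}

lemma IsSolutionCurve.sq_mul_fst (h : IsSolutionCurve k₁ k₂ c₁ c₂ T γ₁ γ₂ s s₁ s₂) (hT : IsOpen T)
    (hγ : IsImmersedCurveInSphere T γ₁ γ₂) {t : ℝ} (ht : t ∈ T) :
    deriv s₁ t ^ 2 * Real.cos (s t) ^ 4 * (Real.cos (s t) ^ k₁ * Real.sin (s t) ^ k₂) ^ 2 =
      c₁ ^ 2 * polarSpeedSq s s₁ s₂ t := by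
  have h1 := congrArg (· ^ 2) (h.mul_fst hT ht)
  simp only [mul_pow c₁, Real.sq_sqrt (h.polar.speedSq_pos hT hγ ht).le] at h1
  rw [← h1]
  ring

lemma IsSolutionCurve.sq_mul_snd (h : IsSolutionCurve k₁ k₂ c₁ c₂ T γ₁ γ₂ s s₁ s₂) (hT : IsOpen T)
    (hγ : IsImmersedCurveInSphere T γ₁ γ₂) {t : ℝ} (ht : t ∈ T) :
    deriv s₂ t ^ 2 * Real.sin (s t) ^ 4 * (Real.cos (s t) ^ k₁ * Real.sin (s t) ^ k₂) ^ 2 =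
      c₂ ^ 2 * polarSpeedSq s s₁ s₂ t := by
  have h1 := congrArg (· ^ 2) (h.mul_snd hT ht)
  simp only [mul_pow c₂, Real.sq_sqrt (h.polar.speedSq_pos hT hγ ht).le] at h1
  rw [← h1]
  ring

/-- Conservation of energy for a solution curve. -/
lemma IsSolutionCurve.energy (h : IsSolutionCurve k₁ k₂ c₁ c₂ T γ₁ γ₂ s s₁ s₂) (hT : IsOpen T)
    (hγ : IsImmersedCurveInSphere T γ₁ γ₂) {t : ℝ} (ht : t ∈ T) :
    deriv s t ^ 2 * Real.cos (s t) ^ 2 * Real.sin (s t) ^ 2 *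
      (Real.cos (s t) ^ k₁ * Real.sin (s t) ^ k₂) ^ 2 =
      polarSpeedSq s s₁ s₂ t * (energyPoly k₁ k₂ c₁ c₂).eval (Real.cos (s t) ^ 2) := by
  have h1 := h.sq_mul_fst hT hγ ht
  have h2 := h.sq_mul_snd hT hγ ht
  have hS : polarSpeedSq s s₁ s₂ t = deriv s t ^ 2 + Real.cos (s t) ^ 2 * deriv s₁ t ^ 2 +
    Real.sin (s t) ^ 2 * deriv s₂ t ^ 2 := rfl
  rw [energyPoly_eval, ← Real.sin_sq]
  have hZ : (Real.cos (s t) ^ 2) ^ (k₁ + 1) * (Real.sin (s t) ^ 2) ^ (k₂ + 1) =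
      Real.cos (s t) ^ 2 * Real.sin (s t) ^ 2 *
        (Real.cos (s t) ^ k₁ * Real.sin (s t) ^ k₂) ^ 2 := by ring
  rw [hZ]
  linear_combination (-Real.cos (s t) ^ 2 * Real.sin (s t) ^ 2 *
    (Real.cos (s t) ^ k₁ * Real.sin (s t) ^ k₂) ^ 2) * hS - Real.sin (s t) ^ 2 * h1 -
    Real.cos (s t) ^ 2 * h2

/-- Energy conservation makes a stationary point of `s` a root of `energyPoly`. By this formula the
root is double exactly when the force also vanishes there. -/
lemma IsSolutionCurve.energyPoly_derivative (h : IsSolutionCurve k₁ k₂ c₁ c₂ T γ₁ γ₂ s s₁ s₂)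
    (hT : IsOpen T) (hγ : IsImmersedCurveInSphere T γ₁ γ₂) {t : ℝ} (ht : t ∈ T)
    (hp : deriv s t = 0) :
    polarSpeedSq s s₁ s₂ t * (energyPoly k₁ k₂ c₁ c₂).derivative.eval (Real.cos (s t) ^ 2) =
      (Real.cos (s t) ^ k₁ * Real.sin (s t) ^ k₂) ^ 2 * (Real.cos (s t) * Real.sin (s t) *
        polarForce k₁ k₂ s s₁ s₂ t) := by
  have h1 := h.sq_mul_fst hT hγ ht
  have h2 := h.sq_mul_snd hT hγ ht
  have hc := h.polar.cos_pos ht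
  have hs := h.polar.sin_pos ht
  have hS : polarSpeedSq s s₁ s₂ t = Real.cos (s t) ^ 2 * deriv s₁ t ^ 2 +
    Real.sin (s t) ^ 2 * deriv s₂ t ^ 2 := by rw [polarSpeedSq, hp]; ring
  rw [energyPoly_derivative_eval, ← Real.sin_sq]
  have hZ : (Real.cos (s t) ^ 2) ^ k₁ * (Real.sin (s t) ^ 2) ^ k₂ =
      (Real.cos (s t) ^ k₁ * Real.sin (s t) ^ k₂) ^ 2 := by ring
  have hκ : Real.cos (s t) * Real.sin (s t) * polarForce k₁ k₂ s s₁ s₂ t =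
      Real.cos (s t) ^ 2 * Real.sin (s t) ^ 2 * (deriv s₁ t ^ 2 - deriv s₂ t ^ 2) +
      polarSpeedSq s s₁ s₂ t * (k₁ * Real.sin (s t) ^ 2 - k₂ * Real.cos (s t) ^ 2) := by
    rw [polarForce, polarKappa]
    field_simp
  rw [hκ, hZ]
  linear_combination -h1 + h2 + (Real.cos (s t) ^ k₁ * Real.sin (s t) ^ k₂) ^ 2 *
    (Real.sin (s t) ^ 2 - Real.cos (s t) ^ 2) * hS

/-- A solution curve that is stationary at one point has constant magnitudes. -/
lemma IsSolutionCurve.eq_of_polarForce_eq_zero (h : IsSolutionCurve k₁ k₂ c₁ c₂ T γ₁ γ₂ s s₁ s₂)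
    (hT : IsOpen T) (hTc : T.OrdConnected) (hγ : IsImmersedCurveInSphere T γ₁ γ₂) {t₀ : ℝ}
    (ht₀ : t₀ ∈ T) (hp : deriv s t₀ = 0) (hf : polarForce k₁ k₂ s s₁ s₂ t₀ = 0) :
    ∀ t ∈ T, s t = s t₀ := by
  have hS₀ := h.polar.speedSq_pos hT hγ ht₀
  have h0 : (energyPoly k₁ k₂ c₁ c₂).eval (Real.cos (s t₀) ^ 2) = 0 := by
    have := h.energy hT hγ ht₀
    rw [hp] at this
    simpa [hS₀.ne'] using this
  have h1 : (energyPoly k₁ k₂ c₁ c₂).derivative.eval (Real.cos (s t₀) ^ 2) = 0 := by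
    have := h.energyPoly_derivative hT hγ ht₀ hp
    rw [hf] at this
    simpa [hS₀.ne'] using this
  obtain ⟨Q, hQ⟩ := Polynomial.exists_eq_sq_mul_of_isRoot h0 h1
  have hs : ContinuousOn s T := h.polar.contDiff.continuousOn
  have hcos : ContinuousOn (fun t => Real.cos (s t)) T := Real.continuous_cos.comp_continuousOn hs
  have hsin : ContinuousOn (fun t => Real.sin (s t)) T := Real.continuous_sin.comp_continuousOn hs
  have hSc : ContinuousOn (polarSpeedSq s s₁ s₂) T := fun t ht =>
    (h.polar.hasDerivAt_speedSq hT ht).continuousAt.continuousWithinAt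
  -- For `z = cos² s` the energy identity gives `z'² = 4 S P(z) / (a^k₁ b^k₂)²`. Splitting off the
  -- double root `(z - z₀)²` leaves the continuous factor `K`.
  have hz := eq_of_deriv_sq_eq hTc (z := fun t => Real.cos (s t) ^ 2)
    (z' := fun t => -2 * Real.cos (s t) * Real.sin (s t) * deriv s t)
    (K := fun t => 4 * polarSpeedSq s s₁ s₂ t * Q.eval (Real.cos (s t) ^ 2) /
      (Real.cos (s t) ^ k₁ * Real.sin (s t) ^ k₂) ^ 2) (z₀ := Real.cos (s t₀) ^ 2) (t₀ := t₀)
    (fun t ht => by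
      refine ((h.polar.contDiff.hasDerivAt_of_isOpen hT ht).cos.fun_pow 2).congr_deriv ?_
      simp only [Nat.cast_ofNat, Nat.add_one_sub_one, pow_one]
      ring)
    (((continuousOn_const.mul hSc).mul (Q.continuous.comp_continuousOn (hcos.pow 2))).div
      (((hcos.pow k₁).mul (hsin.pow k₂)).pow 2) fun t ht => by
        have hc := h.polar.cos_pos ht
        have hs := h.polar.sin_pos ht
        simp only [Pi.pow_apply, Pi.mul_apply]
        positivity)
    (fun t ht => by
      have hc := h.polar.cos_pos ht
      have hs := h.polar.sin_pos ht
      have he := h.energy hT hγ ht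
      rw [hQ] at he
      simp only [Polynomial.eval_mul, Polynomial.eval_pow, Polynomial.eval_sub, Polynomial.eval_X,
        Polynomial.eval_C] at he
      rw [← mul_div_assoc, eq_div_iff (by positivity)]
      linear_combination 4 * he)
    ht₀ rfl
  intro t ht
  have h2 : Real.cos (s t) = Real.cos (s t₀) :=
    (sq_eq_sq₀ (h.polar.cos_pos ht).le (h.polar.cos_pos ht₀).le).mp (hz t ht)
  have hm := h.polar.mem_Ioo t ht
  have hm₀ := h.polar.mem_Ioo t₀ ht₀
  exact Real.injOn_cos ⟨hm.1.le, by linarith [hm.2, Real.pi_pos]⟩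
    ⟨hm₀.1.le, by linarith [hm₀.2, Real.pi_pos]⟩ h2

lemma IsPolarForm.continuousOn_polarResidual (hP : IsPolarForm T γ₁ γ₂ s s₁ s₂)
    (hT : IsOpen T) (hγ : IsImmersedCurveInSphere T γ₁ γ₂) :
    ContinuousOn (polarResidual k₁ k₂ s s₁ s₂) T := by
  have c : ∀ {f : ℝ → ℝ}, ContDiffOn ℝ 2 f T → ContinuousOn (deriv f) T := fun hf =>
    (hf.deriv_of_isOpen hT (m := 1) (by norm_num)).continuousOn
  have c' : ∀ {f : ℝ → ℝ}, ContDiffOn ℝ 2 f T → ContinuousOn (deriv (deriv f)) T := fun hf =>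
    ((hf.deriv_of_isOpen hT (m := 1) (by norm_num)).deriv_of_isOpen hT (m := 0)
      (by norm_num)).continuousOn
  have d0 := c hP.contDiff
  have d1 := c hP.contDiff_fst
  have d2 := c hP.contDiff_snd
  have e0 := c' hP.contDiff
  have e1 := c' hP.contDiff_fst
  have e2 := c' hP.contDiff_snd
  have hcos := hP.contDiffOn_cos.continuousOn
  have hsin := hP.contDiffOn_sin.continuousOn
  have hS : ContinuousOn (polarSpeedSq s s₁ s₂) T := fun t ht =>
    (hP.hasDerivAt_speedSq hT ht).continuousAt.continuousWithinAt
  have hD : ContinuousOn (polarSpeedSqDerivHalf s s₁ s₂) T := by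
    unfold polarSpeedSqDerivHalf
    fun_prop
  have hκ : ContinuousOn (polarKappa k₁ k₂ s) T :=
    (continuousOn_const.mul (hsin.div hcos fun t ht => (hP.cos_pos ht).ne')).sub
      (continuousOn_const.mul (hcos.div hsin fun t ht => (hP.sin_pos ht).ne'))
  have hF : ContinuousOn (polarFactor k₁ k₂ s s₁ s₂) T :=
    (hD.div hS fun t ht => (hP.speedSq_pos hT hγ ht).ne').add (hκ.mul d0)
  unfold polarResidual polarForce
  fun_prop

/-- A solution curve of varying magnitudes satisfies the equation for the magnitudes. -/
lemma IsSolutionCurve.polarResidual_eq_zero_of_varying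
    (h : IsSolutionCurve k₁ k₂ c₁ c₂ T γ₁ γ₂ s s₁ s₂)
    (hT : IsOpen T) (hTc : T.OrdConnected) (hγ : IsImmersedCurveInSphere T γ₁ γ₂)
    (hv : ∃ t ∈ T, ∃ t' ∈ T, s t ≠ s t') : ∀ t ∈ T, polarResidual k₁ k₂ s s₁ s₂ t = 0 := by
  obtain ⟨a, ha, b, hb, hab⟩ := hv
  by_contra! hne
  obtain ⟨t₁, ht₁, hR⟩ := hne
  have d0 : ContinuousOn (deriv s) T :=
    (h.polar.contDiff.deriv_of_isOpen hT (m := 1) (by norm_num)).continuousOn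
  have e0 : ContinuousOn (deriv (deriv s)) T :=
    ((h.polar.contDiff.deriv_of_isOpen hT (m := 1) (by norm_num)).deriv_of_isOpen hT (m := 0)
      (by norm_num)).continuousOn
  have o0 : IsOpen ({0}ᶜ : Set ℝ) := isOpen_compl_singleton
  have hU := (h.polar.continuousOn_polarResidual (k₁ := k₁) (k₂ := k₂) hT hγ).isOpen_inter_preimage
    hT o0
  have hV := (d0.isOpen_inter_preimage hT o0).union (e0.isOpen_inter_preimage hT o0)
  -- On this open set `s' = 0` identically, hence also `s'' = 0`.
  set U := T ∩ polarResidual k₁ k₂ s s₁ s₂ ⁻¹' {0}ᶜ with hUd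
  have hp : ∀ t ∈ U, deriv s t = 0 := fun t ht =>
    (mul_eq_zero.mp (h.deriv_mul_residual hT hγ ht.1)).resolve_right ht.2
  have hp' : ∀ t ∈ U, deriv (deriv s) t = 0 := fun t ht => by
    have he : deriv s =ᶠ[nhds t] fun _ => 0 := Filter.eventually_of_mem (hU.mem_nhds ht) hp
    rw [he.deriv_eq, deriv_const]
  have hdisj : Disjoint U (T ∩ deriv s ⁻¹' {0}ᶜ ∪ T ∩ deriv (deriv s) ⁻¹' {0}ᶜ) := by
    rw [Set.disjoint_left]
    rintro t ht (h1 | h1)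
    · exact h1.2 (hp t ht)
    · exact h1.2 (hp' t ht)
  have hcover : T ⊆ U ∪ (T ∩ deriv s ⁻¹' {0}ᶜ ∪ T ∩ deriv (deriv s) ⁻¹' {0}ᶜ) := by
    intro t ht
    by_cases h1 : deriv s t = 0
    · by_cases h2 : deriv (deriv s) t = 0
      -- A point outside both open sets has `s' = s'' = R = 0`, so the force vanishes and `s` would
      -- be constant.
      · refine Or.inl ⟨ht, fun h3 => hab ?_⟩
        have h3' : polarResidual k₁ k₂ s s₁ s₂ t = 0 := h3
        rw [polarResidual, h1, h2, mul_zero, zero_add, sub_zero] at h3'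
        have := h.eq_of_polarForce_eq_zero hT hTc hγ ht h1 h3'
        rw [this a ha, this b hb]
      · exact Or.inr (Or.inr ⟨ht, h2⟩)
    · exact Or.inr (Or.inl ⟨ht, h1⟩)
  -- Since `U` contains `t₁`, connectedness gives `T ⊆ U`; then `s' = 0` on `T`, contradicting that
  -- `s` varies.
  have hTU := hTc.isPreconnected.subset_left_of_subset_union hU hV hdisj hcover ⟨t₁, ht₁, ht₁, hR⟩
  exact hab (hT.is_const_of_deriv_eq_zero hTc.isPreconnected
    (fun t ht =>
      (h.polar.contDiff.hasDerivAt_of_isOpen hT ht).differentiableAt.differentiableWithinAt)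
    (fun t ht => hp t (hTU ht)) ha hb)

end Varying

/-! ### Existence of polar forms. -/

section Lift

variable {T : Set ℝ}

/-- A nowhere vanishing `C²` complex curve has a `C²` logarithm. -/
lemma exists_contDiffOn_log (hT : IsOpen T) (hTc : T.OrdConnected) {g : ℝ → ℂ}
    (hg : ContDiffOn ℝ 2 g T) (h0 : ∀ t ∈ T, g t ≠ 0) :
    ∃ Ψ : ℝ → ℂ, ContDiffOn ℝ 2 Ψ T ∧ ∀ t ∈ T, g t = Complex.exp (Ψ t) := by
  rcases T.eq_empty_or_nonempty with rfl | ⟨t₀, ht₀⟩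
  · exact ⟨0, contDiffOn_const, by simp⟩
  have hg' : ContDiffOn ℝ 1 (deriv g) T := hg.deriv_of_isOpen hT (by norm_num)
  have hφ : ContDiffOn ℝ 1 (fun t => deriv g t * (g t)⁻¹) T :=
    hg'.mul ((hg.of_le (by norm_num)).inv h0)
  -- The logarithm is a primitive of `g' / g`, normalised at `t₀`; below, `g exp(-Ψ)` has zero
  -- derivative and the value `1` at `t₀`.
  have hΨ : ∀ t ∈ T, HasDerivAt
      (fun t => Complex.log (g t₀) + ∫ τ in t₀..t, deriv g τ * (g τ)⁻¹)
      (deriv g t * (g t)⁻¹) t := by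
    intro t ht
    refine (intervalIntegral.integral_hasDerivAt_right
      (hφ.continuousOn.mono (hTc.uIcc_subset ht₀ ht)).intervalIntegrable
      (hφ.continuousOn.stronglyMeasurableAtFilter hT t ht)
      (hφ.continuousOn.continuousAt (hT.mem_nhds ht))).const_add _
  set Ψ : ℝ → ℂ := fun t => Complex.log (g t₀) + ∫ τ in t₀..t, deriv g τ * (g τ)⁻¹ with hΨd
  refine ⟨Ψ, ?_, ?_⟩
  · rw [show (2 : WithTop ℕ∞) = 1 + 1 by norm_num, contDiffOn_succ_iff_deriv_of_isOpen hT]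
    exact ⟨fun t ht => (hΨ t ht).differentiableAt.differentiableWithinAt, by simp,
      hφ.congr fun t ht => (hΨ t ht).deriv⟩
  · have hd : ∀ t ∈ T, HasDerivAt (fun t => g t * Complex.exp (-Ψ t)) 0 t := by
      intro t ht
      have h1 : HasDerivAt g (deriv g t) t :=
        ((hg.contDiffAt (hT.mem_nhds ht)).differentiableAt (by norm_num)).hasDerivAt
      refine (h1.mul (hΨ t ht).neg.cexp).congr_deriv ?_
      have := h0 t ht
      field_simp
      ring
    intro t ht
    have h1 := hT.is_const_of_deriv_eq_zero hTc.isPreconnected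
      (fun t ht => (hd t ht).differentiableAt.differentiableWithinAt)
      (fun t ht => (hd t ht).deriv) ht ht₀
    have h2 : Ψ t₀ = Complex.log (g t₀) := by simp [hΨd]
    rw [h2, Complex.exp_neg (Complex.log _), Complex.exp_log (h0 t₀ ht₀),
      mul_inv_cancel₀ (h0 t₀ ht₀), Complex.exp_neg] at h1
    exact (mul_inv_eq_one₀ (Complex.exp_ne_zero _)).mp h1

/-- A nowhere vanishing `C²` complex curve has a `C²` argument. -/
lemma exists_contDiffOn_arg (hT : IsOpen T) (hTc : T.OrdConnected) {g : ℝ → ℂ}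
    (hg : ContDiffOn ℝ 2 g T) (h0 : ∀ t ∈ T, g t ≠ 0) :
    ∃ θ : ℝ → ℝ, ContDiffOn ℝ 2 θ T ∧
      ∀ t ∈ T, g t = (‖g t‖ : ℂ) * Complex.exp ((θ t : ℂ) * Complex.I) := by
  obtain ⟨Ψ, hΨ, he⟩ := exists_contDiffOn_log hT hTc hg h0
  refine ⟨fun t => (Ψ t).im, Complex.imCLM.contDiff.comp_contDiffOn hΨ, fun t ht => ?_⟩
  rw [he t ht, Complex.norm_exp, Complex.ofReal_exp, ← Complex.exp_add, Complex.re_add_im]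

lemma IsImmersedCurveInSphere.exists_isPolarForm {γ₁ γ₂ : ℝ → ℂ} (hT : IsOpen T)
    (hTc : T.OrdConnected) (hγ : IsImmersedCurveInSphere T γ₁ γ₂)
    (hγ0 : ∀ t ∈ T, γ₁ t * γ₂ t ≠ 0) : ∃ s s₁ s₂ : ℝ → ℝ, IsPolarForm T γ₁ γ₂ s s₁ s₂ := by
  obtain ⟨s₁, hs₁, he₁⟩ := exists_contDiffOn_arg hT hTc hγ.contDiff_fst
    fun t ht => left_ne_zero_of_mul (hγ0 t ht)
  obtain ⟨s₂, hs₂, he₂⟩ := exists_contDiffOn_arg hT hTc hγ.contDiff_snd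
    fun t ht => right_ne_zero_of_mul (hγ0 t ht)
  have hpos₁ : ∀ t ∈ T, 0 < ‖γ₁ t‖ := fun t ht =>
    norm_pos_iff.mpr (left_ne_zero_of_mul (hγ0 t ht))
  have hpos₂ : ∀ t ∈ T, 0 < ‖γ₂ t‖ := fun t ht =>
    norm_pos_iff.mpr (right_ne_zero_of_mul (hγ0 t ht))
  have hlt : ∀ t ∈ T, ‖γ₁ t‖ < 1 := fun t ht => by
    nlinarith [hγ.mem_sphere t ht, pow_pos (hpos₂ t ht) 2, hpos₁ t ht]
  have hcos : ∀ t ∈ T, Real.cos (Real.arccos ‖γ₁ t‖) = ‖γ₁ t‖ := fun t ht =>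
    Real.cos_arccos (by linarith [hpos₁ t ht]) (hlt t ht).le
  have hsin : ∀ t ∈ T, Real.sin (Real.arccos ‖γ₁ t‖) = ‖γ₂ t‖ := fun t ht => by
    rw [Real.sin_arccos, ← hγ.mem_sphere t ht, add_sub_cancel_left, Real.sqrt_sq (hpos₂ t ht).le]
  -- Since neither component vanishes, `‖γ₁‖` stays strictly between `0` and `1`, where both the
  -- norm and `arccos` are smooth.
  refine ⟨fun t => Real.arccos ‖γ₁ t‖, s₁, s₂, ?_, hs₁, hs₂, fun t ht => ⟨?_, ?_⟩, ?_, ?_⟩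
  · intro t ht
    have h1 : ContDiffWithinAt ℝ 2 (fun t => ‖γ₁ t‖) T t :=
      (hγ.contDiff_fst t ht).norm ℝ (left_ne_zero_of_mul (hγ0 t ht))
    exact ContDiffAt.comp_contDiffWithinAt (g := Real.arccos) t
      (Real.contDiffAt_arccos (by linarith [hpos₁ t ht]) (hlt t ht).ne) h1
  · exact Real.arccos_pos.mpr (hlt t ht)
  · exact Real.arccos_lt_pi_div_two.mpr (hpos₁ t ht)
  · intro t ht
    rw [hcos t ht]
    exact he₁ t ht
  · intro t ht
    rw [hsin t ht]
    exact he₂ t ht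

end Lift

/-- A curve satisfies the spiral equation if and only if it is a solution curve of varying or of
steady magnitudes. -/
theorem spiralEquation_iff_isSolutionCurve {k₁ k₂ : ℕ} {T : Set ℝ} (hT : IsOpen T)
    (hTc : T.OrdConnected) {γ₁ γ₂ : ℝ → ℂ} (hγ : IsImmersedCurveInSphere T γ₁ γ₂)
    (hγ0 : ∀ t ∈ T, γ₁ t * γ₂ t ≠ 0) :
    (∀ t ∈ T, SpiralEquation k₁ k₂ γ₁ γ₂ t) ↔
      (IsVaryingSolutionCurve k₁ k₂ T γ₁ γ₂ ∨ IsSteadySolutionCurve k₁ k₂ T γ₁ γ₂) := by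
  constructor
  · intro h
    obtain ⟨s, s₁, s₂, hP⟩ := hγ.exists_isPolarForm hT hTc hγ0
    rcases T.eq_empty_or_nonempty with rfl | ⟨t₀, ht₀⟩
    -- On an empty interval everything is vacuous except the steady equation, which zero parameters
    -- satisfy.
    · exact Or.inr ⟨0, 0, 0, s, s₁, s₂, ⟨hP, by simp, by simp⟩, by simp, by simp⟩
    obtain ⟨c₁, c₂, hc⟩ := hP.exists_isSolutionCurve hT hTc hγ k₁ k₂ h
    by_cases hv : ∃ t ∈ T, ∃ t' ∈ T, s t ≠ s t'
    · exact Or.inl ⟨c₁, c₂, s, s₁, s₂, hc, hv⟩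
    · push Not at hv
      have hσ : ∀ t ∈ T, s t = s t₀ := fun t ht => hv t ht t₀ ht₀
      exact Or.inr ⟨c₁, c₂, s t₀, s, s₁, s₂, hc, hσ,
        (hc.polarResidual_eq_zero_iff_of_const hT hγ hσ ht₀).mp
          ((hc.spiralEquation_iff hT hγ ht₀).mp (h t₀ ht₀))⟩
  · rintro (⟨c₁, c₂, s, s₁, s₂, hc, hv⟩ | ⟨c₁, c₂, σ, s, s₁, s₂, hc, hσ, he⟩) t ht
    · exact (hc.spiralEquation_iff hT hγ ht).mpr
        (hc.polarResidual_eq_zero_of_varying hT hTc hγ hv t ht)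
    · exact (hc.spiralEquation_iff hT hγ ht).mpr
        ((hc.polarResidual_eq_zero_iff_of_const hT hγ hσ ht).mpr he)

end

theorem mainTheorem2 (k₁ k₂ n₁ n₂ : ℕ) (hk₁ : 0 < k₁) (hk₂ : 0 < k₂)
    {L₁ : Type*} [TopologicalSpace L₁] [ChartedSpace (EuclideanSpace ℝ (Fin k₁)) L₁]
    [IsManifold (𝓡 k₁) ∞ L₁] [Nonempty L₁]
    {L₂ : Type*} [TopologicalSpace L₂] [ChartedSpace (EuclideanSpace ℝ (Fin k₂)) L₂]
    [IsManifold (𝓡 k₂) ∞ L₂] [Nonempty L₂]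
    (f₁ : L₁ → EuclideanSpace ℂ (Fin (n₁ + 1))) (f₂ : L₂ → EuclideanSpace ℂ (Fin (n₂ + 1)))
    (hf₁ : IsMinimalImmersionInSphere (𝓡 k₁) (stdBasis k₁) f₁)
    (hf₂ : IsMinimalImmersionInSphere (𝓡 k₂) (stdBasis k₂) f₂)
    (hc₁ : IsCTotallyReal (𝓡 k₁) f₁) (hc₂ : IsCTotallyReal (𝓡 k₂) f₂)
    (T : Set ℝ) (hTo : IsOpen T) (hTc : T.OrdConnected)
    (γ₁ γ₂ : ℝ → ℂ) (hγ : IsImmersedCurveInSphere T γ₁ γ₂)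
    (hγ0 : ∀ t ∈ T, γ₁ t * γ₂ t ≠ 0) :
    (∀ t ∈ T, ∀ (x : L₁) (y : L₂),
      inducedLaplacian (𝓘(ℝ, ℝ).prod ((𝓡 k₁).prod (𝓡 k₂))) (prodBasis k₁ k₂)
          (spiralProduct γ₁ γ₂ f₁ f₂) (t, (x, y)) =
        (-((k₁ : ℝ) + k₂ + 1)) • spiralProduct γ₁ γ₂ f₁ f₂ (t, (x, y))) ↔
      (IsVaryingSolutionCurve k₁ k₂ T γ₁ γ₂ ∨ IsSteadySolutionCurve k₁ k₂ T γ₁ γ₂) := by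
  rw [← spiralEquation_iff_isSolutionCurve hTo hTc hγ hγ0]
  -- The curve equation at time `t` is read off from the Laplace equation at the single point `(t,
  -- x₀, y₀)`.
  obtain ⟨x₀⟩ := ‹Nonempty L₁›
  obtain ⟨y₀⟩ := ‹Nonempty L₂›
  exact ⟨fun h t ht => (inducedLaplacian_spiralProduct_iff hf₁ hf₂ hc₁ hc₂ hTo hγ hγ0 ht x₀ y₀).mp
      (h t ht x₀ y₀),
    fun h t ht x y => (inducedLaplacian_spiralProduct_iff hf₁ hf₂ hc₁ hc₂ hTo hγ hγ0 ht x y).mpr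
      (h t ht)⟩
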